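/- Let $I_\nu$ denote the modified Bessel function of the first kind of order $\nu$. (i) Let $\nu>0$ and let $X=(X_t)_{t\ge 0}$ be a squared Bessel process of index $\nu$, that is, a continuous $[0,\infty)$-valued (weak) solution of $$\mathrm{d}X_t = 2(\nu+1)\,\mathrm{d}t + 2\sqrt{X_t}\,\mathrm{d}W_t ,$$ with an arbitrary initial distribution on $[0,\infty)$. Then for every $t>0$ the law of $X_t$ has a density $p(t,\cdot)$ on $(0,\infty)$ that is positive and smooth there, and for almost every $x>0$ the score satisfies $$\partial_x \log p(t,x) = s_\nu^{X}(t,x) := \frac{\nu}{x}-\frac{1}{2t}+\frac{1}{2t\sqrt{x}}\,\mathbb{E}\left(\frac{\sqrt{X_0}\,I_{\nu+1}\left(\sqrt{xX_0}/t\right)}{I_{\nu}\left(\sqrt{xX_0}/t\right)}\,\Big|\,X_t=x\right),$$ where the conditional expectation, taken with respect to a regular conditional distribution of $X_0$ given $X_t=x$, is that of an integrable function (whose value at $X_0=0$ is its limit $0$). (ii) Let $\sigma>0$, $\mu>\sigma^2/2$, and let $X$ be a continuous $[0,\infty)$-valued (weak) solution of $\mathrm{d}X_t=\mu\,\mathrm{d}t+\sigma\sqrt{X_t}\,\mathrm{d}W_t$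 with an arbitrary initial distribution on $[0,\infty)$. Then $Z:=\frac{4}{\sigma^2}X$ is a squared Bessel process of index $\frac{2\mu}{\sigma^2}-1$, and for every $t>0$ the law of $X_t$ has a positive smooth density $p(t,\cdot)$ on $(0,\infty)$ such that, for almost every $x>0$, $$\partial_x\log p(t,x)=\frac{4}{\sigma^2}\,s^{Z}_{\frac{2\mu}{\sigma^2}-1}\left(t,\frac{4x}{\sigma^2}\right),$$ where $s^{Z}_\nu$ is defined as in (i) with $Z$ in place of $X$, and the function under the conditional expectation is again integrable. -/

import Mathlib

open MeasureTheory ProbabilityTheory Set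
open scoped NNReal ENNReal Nat

noncomputable section

/-- The modified Bessel function of the first kind
`I_ν(x) = ∑ₖ (x/2)^(2k+ν) / (k! Γ(k+ν+1))`, for real order `ν > -1` and argument `x ≥ 0`. -/
def besselI (ν x : ℝ) : ℝ :=
  ∑' k : ℕ, (x / 2) ^ (2 * (k : ℝ) + ν) / ((k ! : ℝ) * Real.Gamma ((k : ℝ) + ν + 1))

/-- The generator `f ↦ b f' + (1/2) σ² f''` of the one-dimensional equation
`dX = b(X) dt + σ(X) dW`. -/
def sdeGenerator (b σ : ℝ → ℝ) (f : ℝ → ℝ) (x : ℝ) : ℝ :=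
  b x * deriv f x + (1 / 2) * σ x ^ 2 * deriv (deriv f) x

/-- `X` is a continuous, `ℱ`-adapted process with values in `[0, ∞)` that is a (weak) solution of
`dX = b(X) dt + σ(X) dW`, in the sense of the Stroock-Varadhan martingale problem:
`f(X_t) - f(X_0) - ∫₀ᵗ (b f' + (1/2) σ² f'')(X_s) ds` is a martingale for every smooth compactly
supported `f`. The law of `X_0` is arbitrary. -/
structure IsNonnegSDESolution {Ω : Type*} {mΩ : MeasurableSpace Ω} (b σ : ℝ → ℝ)
    (ℱ : Filtration ℝ≥0 mΩ) (P : Measure Ω) (X : ℝ≥0 → Ω → ℝ) : Prop where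
  adapted : StronglyAdapted ℱ X
  continuous_paths : ∀ ω, Continuous fun t => X t ω
  nonneg : ∀ᵐ ω ∂P, ∀ t, 0 ≤ X t ω
  martingale : ∀ f : ℝ → ℝ, ContDiff ℝ (⊤ : ℕ∞) f → HasCompactSupport f →
    Martingale (fun (t : ℝ≥0) ω => f (X t ω) - f (X 0 ω)
      - ∫ s in (0 : ℝ)..(t : ℝ), sdeGenerator b σ f (X s.toNNReal ω)) ℱ P

/-- Squared Bessel process of index `ν`: `dX = 2(ν+1) dt + 2√X dW`. -/
def IsBESQ {Ω : Type*} {mΩ : MeasurableSpace Ω} (ν : ℝ)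
    (ℱ : Filtration ℝ≥0 mΩ) (P : Measure Ω) (X : ℝ≥0 → Ω → ℝ) : Prop :=
  IsNonnegSDESolution (fun _ => 2 * (ν + 1)) (fun x => 2 * √x) ℱ P X

/-- `p` is a density of the measure `m`, which is carried by `(0, ∞)`, and `p` is positive and
smooth there. These properties determine `p` on `(0, ∞)`. -/
structure IsSmoothPosDensity (m : Measure ℝ) (p : ℝ → ℝ) : Prop where
  law : m = (volume.restrict (Ioi 0)).withDensity fun x => ENNReal.ofReal (p x)
  pos : ∀ x, 0 < x → 0 < p x
  smooth : ContDiffOn ℝ (⊤ : ℕ∞) p (Ioi 0)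

/-- The function `z ↦ √z I_{ν+1}(√(xz)/t) / I_ν(√(xz)/t)`; at `z = 0` it is `0`, its limit. -/
def besqRatio (ν t x z : ℝ) : ℝ :=
  √z * besselI (ν + 1) (√(x * z) / t) / besselI ν (√(x * z) / t)

/-- `ν/x - 1/(2t) + (2t√x)⁻¹ E(√X₀ I_{ν+1}(√(xX₀)/t) / I_ν(√(xX₀)/t) | X_t = x)`, the conditional
expectation being the integral against the regular conditional distribution of `X₀` given
`X_t = x`. -/
def besqTweedie {Ω : Type*} {mΩ : MeasurableSpace Ω} (ν : ℝ) (P : Measure Ω) [IsFiniteMeasure P]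
    (X : ℝ≥0 → Ω → ℝ) (t : ℝ≥0) (x : ℝ) : ℝ :=
  ν / x - 1 / (2 * (t : ℝ))
    + 1 / (2 * (t : ℝ) * √x) * ∫ z, besqRatio ν t x z ∂(condDistrib (X 0) (X t) P x)

end

/-! ### Uniqueness of measures through moments and Laplace transforms. -/

open Filter Topology

/-! Only the martingale problem is available, so the law of `X_t` is found through its Laplace
transform `φ(s, c) = E exp(-c X_s)`. Exponentials are limits of test functions, and the generator
maps `exp(-cx)` to `exp(-cx) (-2(ν+1)c + 2c²x)`; hence `∂_s φ = -2(ν+1)c φ - 2c² ∂_c φ`. This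
first-order equation is solved along characteristics (`laplaceAt_eq`): `φ(t, c) = (1+2ct)^(-(ν+1))
φ(0, c/(1+2ct))`. The same holds with the expectation restricted to an event of `ℱ 0`.

With `r = 1/(2t)`, the right side is the Laplace transform of a mixture of Gamma(`k+ν+1`, `r`) laws,
`k` being Poisson with mean `r X_0`. Localising to events `X_0 ∈ B` gives the joint law of `(X_t,
X_0)` (`IsBESQ.joint_law`), with density `q(z, x)` relative to `dx μ₀(dz)`.

Integrating out `z` gives the marginal density `x^ν exp(-rx) S(x)` with `S` an entire power series
with nonnegative coefficients and positive constant term. It is smooth and positive on `(0, ∞)`, and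
its score is `ν/x - r + S'/S`. By Bayes' formula the conditional law of `X_0` is `q(z, x) μ₀(dz) /
p(x)`. Since `q` is proportional to the entire part of `I_ν`, multiplying by the Bessel ratio
replaces it by that of `I_{ν+1}`, which is termwise the series of `S'` up to the factor `√x/r`. So
the posterior mean of the ratio is `(√x/r) S'/S` (`integral_besqRatio_posteriorKernel`), which is
Tweedie's formula. Part (ii) follows by scaling space. -/

/-- Finite measures carried by `[0, 1]` with the same moments agree. -/
theorem measure_ext_of_moments {μ ν : Measure ℝ} [IsFiniteMeasure μ] [IsFiniteMeasure ν]
    (hμ : ∀ᵐ x ∂μ, x ∈ Icc (0 : ℝ) 1) (hν : ∀ᵐ x ∂ν, x ∈ Icc (0 : ℝ) 1)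
    (h : ∀ n : ℕ, ∫ x, x ^ n ∂μ = ∫ x, x ^ n ∂ν) : μ = ν := by
  have hint : ∀ (ρ : Measure ℝ) [IsFiniteMeasure ρ], (∀ᵐ x ∂ρ, x ∈ Icc (0 : ℝ) 1) →
      ∀ n : ℕ, Integrable (fun x : ℝ => x ^ n) ρ := by
    intro ρ _ hρ n
    refine Integrable.of_bound (by fun_prop) 1 ?_
    filter_upwards [hρ] with x hx
    rw [Real.norm_of_nonneg (pow_nonneg hx.1 n)]
    exact pow_le_one₀ hx.1 hx.2
  have hpint : ∀ (ρ : Measure ℝ) [IsFiniteMeasure ρ], (∀ᵐ x ∂ρ, x ∈ Icc (0 : ℝ) 1) →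
      ∀ p : Polynomial ℝ, Integrable (fun x : ℝ => p.eval x) ρ := by
    intro ρ _ hρ p
    simp_rw [Polynomial.eval_eq_sum_range]
    exact integrable_finsetSum _ fun i _ => (hint ρ hρ i).const_mul _
  have hpoly : ∀ p : Polynomial ℝ, ∫ x, p.eval x ∂μ = ∫ x, p.eval x ∂ν := by
    intro p
    simp_rw [Polynomial.eval_eq_sum_range]
    rw [integral_finsetSum _ fun i _ => (hint μ hμ i).const_mul _,
      integral_finsetSum _ fun i _ => (hint ν hν i).const_mul _]
    simp_rw [integral_const_mul, h]
  refine ext_of_forall_integral_eq_of_IsFiniteMeasure fun f => ?_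
  have hclose : ∀ (ρ : Measure ℝ) [IsFiniteMeasure ρ], (∀ᵐ x ∂ρ, x ∈ Icc (0 : ℝ) 1) →
      ∀ (p : Polynomial ℝ) (ε : ℝ), (∀ x ∈ Icc (0 : ℝ) 1, |p.eval x - f x| < ε) →
      |∫ x, p.eval x ∂ρ - ∫ x, f x ∂ρ| ≤ ε * ρ.real univ := by
    intro ρ _ hρ p ε hp
    rw [← integral_sub (hpint ρ hρ p) (f.integrable ρ), ← Real.norm_eq_abs]
    refine norm_integral_le_of_norm_le_const ?_
    filter_upwards [hρ] with x hx using (hp x hx).le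
  refine eq_of_forall_dist_le fun ε hε => ?_
  -- The `+ 1` keeps `m` positive even if both measures vanish.
  set m := μ.real univ + ν.real univ + 1 with hm
  have hm0 : 0 < m := by positivity
  obtain ⟨p, hp⟩ := exists_polynomial_near_of_continuousOn 0 1 f f.continuous.continuousOn
    (ε / m) (by positivity)
  have h1 := hclose μ hμ p _ hp
  have h2 := hclose ν hν p _ hp
  rw [hpoly p] at h1
  rw [Real.dist_eq]
  calc |∫ x, f x ∂μ - ∫ x, f x ∂ν|
      = |(∫ x, p.eval x ∂ν - ∫ x, f x ∂ν) - (∫ x, p.eval x ∂ν - ∫ x, f x ∂μ)| := by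
        congr 1; ring
    _ ≤ ε / m * ν.real univ + ε / m * μ.real univ := (abs_sub _ _).trans (add_le_add h2 h1)
    _ ≤ ε / m * m := by rw [← mul_add]; gcongr; linarith
    _ = ε := by field_simp

/-- Finite measures carried by `[0, ∞)` are determined by their Laplace transform at the
natural numbers. -/
theorem measure_ext_of_laplace {μ ν : Measure ℝ} [IsFiniteMeasure μ] [IsFiniteMeasure ν]
    (hμ : ∀ᵐ x ∂μ, 0 ≤ x) (hν : ∀ᵐ x ∂ν, 0 ≤ x)
    (h : ∀ n : ℕ, ∫ x, Real.exp (-(n * x)) ∂μ = ∫ x, Real.exp (-(n * x)) ∂ν) : μ = ν := by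
  have hm : Measurable fun x : ℝ => Real.exp (-x) := by fun_prop
  have hl : Measurable fun x : ℝ => -Real.log x := by fun_prop
  -- The map `x ↦ exp(-x)` turns Laplace transforms at `n` into `n`-th moments on `[0, 1]`, and
  -- `-log` inverts it, so nothing is lost.
  have key : μ.map (fun x => Real.exp (-x)) = ν.map fun x => Real.exp (-x) := by
    have hcar : ∀ ρ : Measure ℝ, (∀ᵐ x ∂ρ, 0 ≤ x) →
        ∀ᵐ y ∂(ρ.map fun x => Real.exp (-x)), y ∈ Icc (0 : ℝ) 1 := by
      intro ρ hρ
      refine (ae_map_iff (p := fun y => y ∈ Icc (0 : ℝ) 1) hm.aemeasurable measurableSet_Icc).2 ?_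
      filter_upwards [hρ] with x hx
      exact ⟨(Real.exp_pos _).le, Real.exp_le_one_iff.2 (by linarith)⟩
    refine measure_ext_of_moments (hcar μ hμ) (hcar ν hν) fun n => ?_
    rw [integral_map hm.aemeasurable (by fun_prop), integral_map hm.aemeasurable (by fun_prop)]
    simp_rw [← Real.exp_nat_mul, mul_neg]
    exact h n
  have hinv : ∀ ρ : Measure ℝ,
      (ρ.map fun x => Real.exp (-x)).map (fun x => -Real.log x) = ρ := by
    intro ρ
    rw [Measure.map_map hl hm]
    convert Measure.map_id using 2
    ext x
    simp
  rw [← hinv μ, key, hinv ν]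

/-! ### Exponentials as limits of test functions. -/

theorem continuous_sdeGenerator {b σ f : ℝ → ℝ} (hb : Continuous b) (hσ : Continuous σ)
    (hf : ContDiff ℝ (⊤ : ℕ∞) f) : Continuous (sdeGenerator b σ f) := by
  have h1 : ContDiff ℝ (⊤ : ℕ∞) (deriv f) := (contDiff_infty_iff_deriv.1 hf).2
  have h2 : ContDiff ℝ (⊤ : ℕ∞) (deriv (deriv f)) := (contDiff_infty_iff_deriv.1 h1).2
  have := h1.continuous
  have := h2.continuous
  unfold sdeGenerator
  fun_prop

/-- Follows from `1 + cx ≤ exp(cx)`. It controls the unbounded factor `x` of the squared diffusion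
coefficient. -/
theorem mul_exp_neg_le {c x : ℝ} (hc : 0 < c) : x * Real.exp (-(c * x)) ≤ 1 / c := by
  have h := Real.add_one_le_exp (c * x)
  rw [Real.exp_neg, ← div_eq_mul_inv, div_le_div_iff₀ (Real.exp_pos _) hc]
  linarith

/-- The exponentials `x ↦ exp (-c x)` are, on `[0, ∞)`, bounded pointwise limits of test
functions, together with their images under the squared Bessel generator. -/
theorem exists_testFunction_approx_exp (ν : ℝ) {c : ℝ} (hc : 0 < c) :
    ∃ (f : ℕ → ℝ → ℝ) (C : ℝ), (∀ n, ContDiff ℝ (⊤ : ℕ∞) (f n)) ∧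
      (∀ n, HasCompactSupport (f n)) ∧
      (∀ n x, 0 ≤ x → |f n x| ≤ 1) ∧
      (∀ x, 0 ≤ x → Tendsto (fun n => f n x) atTop (𝓝 (Real.exp (-(c * x))))) ∧
      (∀ n x, 0 ≤ x →
        |sdeGenerator (fun _ => 2 * (ν + 1)) (fun x => 2 * √x) (f n) x| ≤ C) ∧
      (∀ x, 0 ≤ x → Tendsto
        (fun n => sdeGenerator (fun _ => 2 * (ν + 1)) (fun x => 2 * √x) (f n) x) atTop
        (𝓝 (Real.exp (-(c * x)) * (-(2 * (ν + 1) * c) + 2 * c ^ 2 * x)))) := by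
  -- The approximants are `exp(-cx) χ(x/(n+1))`: each derivative falling on the cutoff brings a
  -- factor `1/(n+1)`, so these terms stay bounded and vanish in the limit.
  let χ : ContDiffBump (0 : ℝ) := ⟨1, 2, one_pos, one_lt_two⟩
  have hχ : ContDiff ℝ (⊤ : ℕ∞) χ := χ.contDiff
  have hχ1 : ContDiff ℝ (⊤ : ℕ∞) (deriv χ) := (contDiff_infty_iff_deriv.1 hχ).2
  have hχ2 : ContDiff ℝ (⊤ : ℕ∞) (deriv (deriv χ)) := (contDiff_infty_iff_deriv.1 hχ1).2
  have hs : HasCompactSupport χ := χ.hasCompactSupport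
  obtain ⟨C1, hC1⟩ := hs.deriv.exists_bound_of_continuous hχ1.continuous
  obtain ⟨C2, hC2⟩ := hs.deriv.deriv.exists_bound_of_continuous hχ2.continuous
  simp only [Real.norm_eq_abs] at hC1 hC2
  have hC1n : 0 ≤ C1 := (abs_nonneg _).trans (hC1 0)
  have hC2n : 0 ≤ C2 := (abs_nonneg _).trans (hC2 0)
  have hd : ∀ x, HasDerivAt χ (deriv χ x) x := fun x =>
    (hχ.differentiable (by simp) x).hasDerivAt
  have hd1 : ∀ x, HasDerivAt (deriv χ) (deriv (deriv χ) x) x := fun x =>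
    (hχ1.differentiable (by simp) x).hasDerivAt
  let a : ℕ → ℝ := fun n => 1 / ((n : ℝ) + 1)
  have ha0 : ∀ n, 0 < a n := fun n => by positivity
  have ha1 : ∀ n, a n ≤ 1 := fun n => by
    simp only [a]; rw [div_le_one (by positivity)]; linarith [Nat.cast_nonneg (α := ℝ) n]
  have hat : Tendsto a atTop (𝓝 0) := tendsto_one_div_add_atTop_nhds_zero_nat
  have hax : ∀ x, Tendsto (fun n => a n * x) atTop (𝓝 0) := fun x => by
    simpa using hat.mul_const x
  have hE : ∀ x, HasDerivAt (fun x => Real.exp (-(c * x))) (Real.exp (-(c * x)) * (-c)) x :=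
    fun x => by simpa using (((hasDerivAt_id x).const_mul c).neg).exp
  have hA : ∀ n x, HasDerivAt (fun x => a n * x) (a n) x := fun n x => by
    simpa using (hasDerivAt_id x).const_mul (a n)
  have hf1 : ∀ n x, HasDerivAt (fun x => Real.exp (-(c * x)) * χ (a n * x))
      (Real.exp (-(c * x)) * (-c * χ (a n * x) + a n * deriv χ (a n * x))) x := by
    intro n x
    convert! (hE x).mul ((hd _).comp x (hA n x)) using 1
    simp only [Function.comp_apply]; ring
  have hf2 : ∀ n x, HasDerivAt
      (fun x => Real.exp (-(c * x)) * (-c * χ (a n * x) + a n * deriv χ (a n * x)))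
      (Real.exp (-(c * x)) * (c ^ 2 * χ (a n * x) - 2 * c * a n * deriv χ (a n * x)
        + a n ^ 2 * deriv (deriv χ) (a n * x))) x := by
    intro n x
    convert! (hE x).mul ((((hd _).comp x (hA n x)).const_mul (-c)).add
      (((hd1 _).comp x (hA n x)).const_mul (a n))) using 1
    simp only [Function.comp_apply, Pi.add_apply]; ring
  have hL : ∀ n x, 0 ≤ x → sdeGenerator (fun _ => 2 * (ν + 1)) (fun x => 2 * √x)
      (fun x => Real.exp (-(c * x)) * χ (a n * x)) x =
      2 * (ν + 1) *
        (Real.exp (-(c * x)) * (-c * χ (a n * x) + a n * deriv χ (a n * x))) +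
      2 * (x * Real.exp (-(c * x))) * (c ^ 2 * χ (a n * x) - 2 * c * a n * deriv χ (a n * x)
        + a n ^ 2 * deriv (deriv χ) (a n * x)) := by
    intro n x hx
    have e1 : deriv (fun x => Real.exp (-(c * x)) * χ (a n * x)) =
      fun x => Real.exp (-(c * x)) * (-c * χ (a n * x) + a n * deriv χ (a n * x)) :=
      funext fun x => (hf1 n x).deriv
    rw [sdeGenerator, e1, (hf2 n x).deriv, mul_pow, Real.sq_sqrt hx]
    ring
  refine ⟨fun n x => Real.exp (-(c * x)) * χ (a n * x),
    2 * |ν + 1| * (1 * (c + C1)) + 2 * (1 / c) * (c ^ 2 + 2 * c * C1 + C2),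
    fun n => ?_, fun n => ?_, fun n x hx => ?_, fun x hx => ?_, fun n x hx => ?_,
    fun x hx => ?_⟩
  · exact ContDiff.mul (by fun_prop) (hχ.comp (by fun_prop))
  · have : HasCompactSupport fun x => χ (a n * x) :=
      hs.comp_homeomorph (Homeomorph.mulLeft₀ (a n) (ha0 n).ne')
    exact this.mul_left
  · rw [abs_mul, abs_of_pos (Real.exp_pos _), abs_of_nonneg (χ.nonneg)]
    exact mul_le_one₀ (Real.exp_le_one_iff.2 (by nlinarith)) χ.nonneg χ.le_one
  · have h1 : Tendsto (fun n => χ (a n * x)) atTop (𝓝 (χ 0)) :=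
      (hχ.continuous.tendsto 0).comp (hax x)
    have h2 : χ (0 : ℝ) = 1 := χ.one_of_mem_closedBall (by simp [χ])
    rw [h2] at h1
    simpa using h1.const_mul (Real.exp (-(c * x)))
  · rw [hL n x hx]
    have b1 : |Real.exp (-(c * x))| ≤ 1 := by
      rw [abs_of_pos (Real.exp_pos _)]; exact Real.exp_le_one_iff.2 (by nlinarith)
    have b2 : |x * Real.exp (-(c * x))| ≤ 1 / c := by
      rw [abs_of_nonneg (by positivity)]; exact mul_exp_neg_le hc
    have b3 : |χ (a n * x)| ≤ 1 := by rw [abs_of_nonneg χ.nonneg]; exact χ.le_one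
    have b4 := hC1 (a n * x)
    have b5 := hC2 (a n * x)
    have b6 : |-c * χ (a n * x) + a n * deriv χ (a n * x)| ≤ c + C1 := by
      refine (abs_add_le _ _).trans (add_le_add ?_ ?_)
      · rw [abs_mul, abs_neg, abs_of_pos hc]; nlinarith
      · rw [abs_mul, abs_of_pos (ha0 n)]
        nlinarith [ha1 n, ha0 n]
    have b7 : |c ^ 2 * χ (a n * x) - 2 * c * a n * deriv χ (a n * x)
        + a n ^ 2 * deriv (deriv χ) (a n * x)| ≤ c ^ 2 + 2 * c * C1 + C2 := by
      have han2 : a n ^ 2 ≤ 1 := pow_le_one₀ (ha0 n).le (ha1 n)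
      refine (abs_add_le _ _).trans (add_le_add ((abs_sub _ _).trans (add_le_add ?_ ?_)) ?_)
      · rw [abs_mul, abs_of_pos (by positivity)]; nlinarith [sq_nonneg c]
      · rw [abs_mul, abs_of_pos (by have := ha0 n; positivity), mul_assoc (2 * c)]
        gcongr
        nlinarith [ha1 n, ha0 n]
      · rw [abs_mul, abs_of_nonneg (by positivity)]
        nlinarith [sq_nonneg (a n)]
    refine (abs_add_le _ _).trans (add_le_add ?_ ?_)
    · rw [abs_mul, abs_mul, abs_mul, abs_of_pos (zero_lt_two' ℝ)]; gcongr
    · rw [abs_mul, abs_mul, abs_of_pos (zero_lt_two' ℝ)]; gcongr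
  · simp_rw [hL _ x hx]
    have h2 : χ (0 : ℝ) = 1 := χ.one_of_mem_closedBall (by simp [χ])
    have t0 : Tendsto (fun n => χ (a n * x)) atTop (𝓝 1) :=
      h2 ▸ (hχ.continuous.tendsto 0).comp (hax x)
    have t1 : Tendsto (fun n => deriv χ (a n * x)) atTop (𝓝 (deriv χ 0)) :=
      (hχ1.continuous.tendsto 0).comp (hax x)
    have t2 : Tendsto (fun n => deriv (deriv χ) (a n * x)) atTop (𝓝 (deriv (deriv χ) 0)) :=
      (hχ2.continuous.tendsto 0).comp (hax x)
    have := ((((t0.const_mul (-c)).add (hat.mul t1)).const_mul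
      (Real.exp (-(c * x)))).const_mul (2 * (ν + 1))).add
      ((((t0.const_mul (c ^ 2)).sub (((hat.const_mul (2 * c)).mul t1))).add
      ((hat.pow 2).mul t2)).const_mul (2 * (x * Real.exp (-(c * x)))))
    refine this.congr' (Eventually.of_forall fun n => rfl) |>.trans (le_of_eq ?_)
    congr 1
    ring

/-! ### The Laplace transform and its transport equation. -/

noncomputable section Laplace

variable {Ω : Type*} {mΩ : MeasurableSpace Ω} {Q : Measure Ω} [IsFiniteMeasure Q]
  {Y : ℝ≥0 → Ω → ℝ}

theorem measurable_uncurry_toNNReal (hm : ∀ t, Measurable (Y t))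
    (hc : ∀ ω, Continuous fun t => Y t ω) :
    Measurable fun p : ℝ × Ω => Y p.1.toNNReal p.2 :=
  measurable_uncurry_of_continuous_of_measurable (u := fun (s : ℝ) ω => Y s.toNNReal ω)
    (fun ω => (hc ω).comp continuous_real_toNNReal) fun _ => hm _

/-- Passage to the limit in the mean-zero property of the test martingales. -/
theorem integral_test_eq_zero_of_tendsto (hm : ∀ t, Measurable (Y t))
    (hc : ∀ ω, Continuous fun t => Y t ω) (h0 : ∀ t ω, 0 ≤ Y t ω)
    {f g : ℕ → ℝ → ℝ} {F G : ℝ → ℝ} {C D : ℝ}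
    (hf : ∀ n, Measurable (f n)) (hg : ∀ n, Measurable (g n))
    (hfD : ∀ n x, 0 ≤ x → |f n x| ≤ D)
    (hfF : ∀ x, 0 ≤ x → Tendsto (fun n => f n x) atTop (𝓝 (F x)))
    (hgC : ∀ n x, 0 ≤ x → |g n x| ≤ C)
    (hgG : ∀ x, 0 ≤ x → Tendsto (fun n => g n x) atTop (𝓝 (G x))) (t : ℝ≥0)
    (h : ∀ n, ∫ ω, (f n (Y t ω) - f n (Y 0 ω)
      - ∫ s in (0 : ℝ)..t, g n (Y s.toNNReal ω)) ∂Q = 0) :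
    ∫ ω, (F (Y t ω) - F (Y 0 ω) - ∫ s in (0 : ℝ)..t, G (Y s.toNNReal ω)) ∂Q = 0 := by
  have hY := measurable_uncurry_toNNReal hm hc
  have hb : ∀ n ω, ‖∫ s in (0 : ℝ)..t, g n (Y s.toNNReal ω)‖ ≤ C * t := by
    intro n ω
    have := intervalIntegral.norm_integral_le_of_norm_le_const (a := (0 : ℝ)) (b := t) (C := C)
      (f := fun s => g n (Y s.toNNReal ω)) fun s _ => hgC n _ (h0 _ _)
    simpa using this
  have hmeas : ∀ n, AEStronglyMeasurable
      (fun ω => ∫ s in (0 : ℝ)..t, g n (Y s.toNNReal ω)) Q := by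
    intro n
    simp_rw [intervalIntegral.integral_of_le t.coe_nonneg]
    have hYs : Measurable fun p : Ω × ℝ => Y p.2.toNNReal p.1 := hY.comp measurable_swap
    have := ((hg n).comp hYs).stronglyMeasurable
    exact (StronglyMeasurable.integral_prod_right' (ν := volume.restrict (Ioc (0 : ℝ) t))
      this).aestronglyMeasurable
  have hlim : Tendsto (fun n => ∫ ω, (f n (Y t ω) - f n (Y 0 ω)
      - ∫ s in (0 : ℝ)..t, g n (Y s.toNNReal ω)) ∂Q) atTop
      (𝓝 (∫ ω, (F (Y t ω) - F (Y 0 ω) - ∫ s in (0 : ℝ)..t, G (Y s.toNNReal ω)) ∂Q)) := by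
    refine tendsto_integral_of_dominated_convergence (fun _ => D + D + C * t) (fun n => ?_)
      (integrable_const _) (fun n => ae_of_all _ fun ω => ?_) (ae_of_all _ fun ω => ?_)
    · exact (((hf n).comp (hm t)).sub ((hf n).comp (hm 0))).aestronglyMeasurable.sub (hmeas n)
    · refine (norm_sub_le _ _).trans (add_le_add ((norm_sub_le _ _).trans ?_) (hb n ω))
      exact add_le_add (hfD _ _ (h0 _ _)) (hfD _ _ (h0 _ _))
    · refine ((hfF _ (h0 _ _)).sub (hfF _ (h0 _ _))).sub ?_
      refine intervalIntegral.tendsto_integral_filter_of_dominated_convergence (fun _ => C)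
        (Eventually.of_forall fun n => ?_) (Eventually.of_forall fun n => ae_of_all _ fun s _ => ?_)
        (by simp) (ae_of_all _ fun s _ => hgG _ (h0 _ _))
      · exact ((hg n).comp (hY.comp measurable_prodMk_right)).aestronglyMeasurable
      · exact hgC _ _ (h0 _ _)
  refine tendsto_nhds_unique hlim ?_
  simp_rw [h]
  exact tendsto_const_nhds

/-- The Laplace transform of the law at time `s`, as a function of time and argument. -/
def laplaceAt (Q : Measure Ω) (Y : ℝ≥0 → Ω → ℝ) (s c : ℝ) : ℝ :=
  ∫ ω, Real.exp (-(c * Y s.toNNReal ω)) ∂Q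

/-- The derivative of the Laplace transform in its argument. -/
def laplaceAtDeriv (Q : Measure Ω) (Y : ℝ≥0 → Ω → ℝ) (s c : ℝ) : ℝ :=
  ∫ ω, -(Y s.toNNReal ω * Real.exp (-(c * Y s.toNNReal ω))) ∂Q

theorem continuousAt_laplaceAt (hm : ∀ t, Measurable (Y t))
    (hc : ∀ ω, Continuous fun t => Y t ω) (h0 : ∀ t ω, 0 ≤ Y t ω) (s : ℝ) {c : ℝ} (hcp : 0 < c) :
    ContinuousAt (fun p : ℝ × ℝ => laplaceAt Q Y p.1 p.2) (s, c) := by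
  have hcn : ∀ ω, Continuous fun s : ℝ => Y s.toNNReal ω := fun ω =>
    (hc ω).comp continuous_real_toNNReal
  refine continuousAt_of_dominated (bound := fun _ => 1)
    (Eventually.of_forall fun p => ?_) ?_ (integrable_const _) (ae_of_all _ fun ω => ?_)
  · have := hm p.1.toNNReal
    fun_prop
  · have : ∀ᶠ p : ℝ × ℝ in 𝓝 (s, c), 0 < p.2 :=
      (continuous_snd.tendsto (s, c)).eventually (lt_mem_nhds hcp)
    filter_upwards [this] with p hp
    refine ae_of_all _ fun ω => ?_
    rw [Real.norm_of_nonneg (Real.exp_pos _).le]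
    exact Real.exp_le_one_iff.2 (by have := mul_nonneg hp.le (h0 p.1.toNNReal ω); linarith)
  · have := hcn ω
    fun_prop

theorem continuousAt_laplaceAtDeriv (hm : ∀ t, Measurable (Y t))
    (hc : ∀ ω, Continuous fun t => Y t ω) (h0 : ∀ t ω, 0 ≤ Y t ω) (s : ℝ) {c : ℝ} (hcp : 0 < c) :
    ContinuousAt (fun p : ℝ × ℝ => laplaceAtDeriv Q Y p.1 p.2) (s, c) := by
  have hcn : ∀ ω, Continuous fun s : ℝ => Y s.toNNReal ω := fun ω =>
    (hc ω).comp continuous_real_toNNReal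
  -- Arguments near `c` exceed `c/2`, which makes the bound `1/c` of `mul_exp_neg_le` locally
  -- uniform.
  refine continuousAt_of_dominated (bound := fun _ => 1 / (c / 2))
    (Eventually.of_forall fun p => ?_) ?_ (integrable_const _) (ae_of_all _ fun ω => ?_)
  · have := hm p.1.toNNReal
    fun_prop
  · have : ∀ᶠ p : ℝ × ℝ in 𝓝 (s, c), c / 2 < p.2 :=
      (continuous_snd.tendsto (s, c)).eventually (lt_mem_nhds (by simpa using hcp))
    filter_upwards [this] with p hp
    refine ae_of_all _ fun ω => ?_
    have hp0 : 0 < p.2 := by linarith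
    rw [norm_neg, Real.norm_of_nonneg (mul_nonneg (h0 _ _) (Real.exp_pos _).le)]
    exact (mul_exp_neg_le hp0).trans (by gcongr)
  · have := hcn ω
    fun_prop

theorem hasDerivAt_laplaceAt (hm : ∀ t, Measurable (Y t)) (h0 : ∀ t ω, 0 ≤ Y t ω) (s : ℝ)
    {c : ℝ} (hcp : 0 < c) : HasDerivAt (laplaceAt Q Y s) (laplaceAtDeriv Q Y s c) c := by
  have hms := hm s.toNNReal
  have hnb : Ioi (c / 2) ∈ 𝓝 c := Ioi_mem_nhds (by linarith)
  refine (hasDerivAt_integral_of_dominated_loc_of_deriv_le (μ := Q)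
    (F := fun c ω => Real.exp (-(c * Y s.toNNReal ω)))
    (F' := fun c ω => -(Y s.toNNReal ω * Real.exp (-(c * Y s.toNNReal ω))))
    (bound := fun _ => 1 / (c / 2)) hnb (Eventually.of_forall fun c => ?_) ?_ ?_
    (ae_of_all _ fun ω d hd => ?_) (integrable_const _) (ae_of_all _ fun ω d hd => ?_)).2
  · fun_prop
  · refine Integrable.of_bound (by fun_prop) 1 (ae_of_all _ fun ω => ?_)
    rw [Real.norm_of_nonneg (Real.exp_pos _).le]
    exact Real.exp_le_one_iff.2 (by have := mul_nonneg hcp.le (h0 s.toNNReal ω); linarith)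
  · fun_prop
  · have hd0 : 0 < d := lt_trans (by linarith) hd
    rw [norm_neg, Real.norm_of_nonneg (mul_nonneg (h0 _ _) (Real.exp_pos _).le)]
    exact (mul_exp_neg_le hd0).trans (by gcongr; exact (le_of_lt hd))
  · have := ((hasDerivAt_id d).mul_const (Y s.toNNReal ω)).neg.exp
    convert! this using 1
    simp
    ring

/-- The integrated Kolmogorov equation for the Laplace transform. -/
theorem laplaceAt_eq_add_integral {ν : ℝ} (hm : ∀ t, Measurable (Y t))
    (hc : ∀ ω, Continuous fun t => Y t ω) (h0 : ∀ t ω, 0 ≤ Y t ω)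
    (hQ : ∀ f : ℝ → ℝ, ContDiff ℝ (⊤ : ℕ∞) f → HasCompactSupport f → ∀ t : ℝ≥0,
      ∫ ω, (f (Y t ω) - f (Y 0 ω) - ∫ s in (0 : ℝ)..t,
        sdeGenerator (fun _ => 2 * (ν + 1)) (fun x => 2 * √x) f (Y s.toNNReal ω)) ∂Q = 0)
    {c : ℝ} (hcp : 0 < c) {s : ℝ} (hs : 0 ≤ s) :
    laplaceAt Q Y s c = laplaceAt Q Y 0 c + ∫ u in (0 : ℝ)..s,
      (-(2 * (ν + 1) * c) * laplaceAt Q Y u c - 2 * c ^ 2 * laplaceAtDeriv Q Y u c) := by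
  obtain ⟨f, C, hf, hfs, hf1, hfl, hfC, hfL⟩ := exists_testFunction_approx_exp ν hcp
  have key := integral_test_eq_zero_of_tendsto (Q := Q) hm hc h0
    (fun n => (hf n).continuous.measurable)
    (fun n => (continuous_sdeGenerator (b := fun _ => 2 * (ν + 1)) (σ := fun x => 2 * √x)
      (by fun_prop) (by fun_prop) (hf n)).measurable) hf1 hfl hfC hfL s.toNNReal
    (fun n => hQ (f n) (hf n) (hfs n) s.toNNReal)
  have hY := measurable_uncurry_toNNReal hm hc
  -- The limit inherits the uniform bound `C`, which justifies Fubini below.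
  have hCG : ∀ x, 0 ≤ x → |Real.exp (-(c * x)) * (-(2 * (ν + 1) * c) + 2 * c ^ 2 * x)| ≤ C :=
    fun x hx => le_of_tendsto' (hfL x hx).abs fun n => hfC n x hx
  have hexp : ∀ t, Integrable (fun ω => Real.exp (-(c * Y t ω))) Q := fun t => by
    have := hm t
    refine Integrable.of_bound (by fun_prop) 1 (ae_of_all _ fun ω => ?_)
    rw [Real.norm_of_nonneg (Real.exp_pos _).le]
    exact Real.exp_le_one_iff.2 (by have := mul_nonneg hcp.le (h0 t ω); linarith)
  have hexp' : ∀ t, Integrable (fun ω => -(Y t ω * Real.exp (-(c * Y t ω)))) Q := fun t => by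
    have := hm t
    refine Integrable.of_bound (by fun_prop) (1 / c) (ae_of_all _ fun ω => ?_)
    rw [norm_neg, Real.norm_of_nonneg (mul_nonneg (h0 _ _) (Real.exp_pos _).le)]
    exact mul_exp_neg_le hcp
  have hprod : Integrable (Function.uncurry fun (u : ℝ) (ω : Ω) =>
      Real.exp (-(c * Y u.toNNReal ω)) * (-(2 * (ν + 1) * c) + 2 * c ^ 2 * Y u.toNNReal ω))
      ((volume.restrict (uIoc 0 s)).prod Q) := by
    have : IsFiniteMeasure (volume.restrict (uIoc 0 s)) := by
      rw [uIoc_of_le hs]; infer_instance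
    refine Integrable.of_bound ?_ C (ae_of_all _ fun p => hCG _ (h0 _ _))
    refine Measurable.aestronglyMeasurable ?_
    exact (by fun_prop : Measurable fun x : ℝ =>
      Real.exp (-(c * x)) * (-(2 * (ν + 1) * c) + 2 * c ^ 2 * x)).comp hY
  rw [Real.coe_toNNReal s hs] at key
  have hswap := intervalIntegral_integral_swap hprod
  have hin : Integrable (fun ω => ∫ u in (0 : ℝ)..s, Real.exp (-(c * Y u.toNNReal ω)) *
      (-(2 * (ν + 1) * c) + 2 * c ^ 2 * Y u.toNNReal ω)) Q := by
    simp_rw [intervalIntegral.integral_of_le hs]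
    rw [uIoc_of_le hs] at hprod
    exact hprod.integral_prod_right
  rw [integral_sub (f := fun ω => Real.exp (-(c * Y s.toNNReal ω)) - Real.exp (-(c * Y 0 ω)))
    ((hexp _).sub (hexp _)) hin, integral_sub (hexp _) (hexp _), ← hswap] at key
  have hpt : ∀ u : ℝ, ∫ ω, Real.exp (-(c * Y u.toNNReal ω)) *
      (-(2 * (ν + 1) * c) + 2 * c ^ 2 * Y u.toNNReal ω) ∂Q =
      -(2 * (ν + 1) * c) * laplaceAt Q Y u c - 2 * c ^ 2 * laplaceAtDeriv Q Y u c := by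
    intro u
    rw [laplaceAt, laplaceAtDeriv, ← integral_const_mul, ← integral_const_mul,
      ← integral_sub ((hexp _).const_mul _) ((hexp' _).const_mul _)]
    congr 1; ext ω; ring
  simp_rw [hpt] at key
  simp only [laplaceAt, Real.toNNReal_zero] at key ⊢
  linarith

/-- The Laplace transform of a squared Bessel process, by the method of characteristics. -/
theorem laplaceAt_eq {ν : ℝ} (hm : ∀ t, Measurable (Y t))
    (hc : ∀ ω, Continuous fun t => Y t ω) (h0 : ∀ t ω, 0 ≤ Y t ω)
    (hQ : ∀ f : ℝ → ℝ, ContDiff ℝ (⊤ : ℕ∞) f → HasCompactSupport f → ∀ t : ℝ≥0,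
      ∫ ω, (f (Y t ω) - f (Y 0 ω) - ∫ s in (0 : ℝ)..t,
        sdeGenerator (fun _ => 2 * (ν + 1)) (fun x => 2 * √x) f (Y s.toNNReal ω)) ∂Q = 0)
    {c : ℝ} (hcp : 0 < c) {t : ℝ} (ht : 0 < t) :
    laplaceAt Q Y t c =
      (1 + 2 * c * t) ^ (-(ν + 1)) * laplaceAt Q Y 0 (c / (1 + 2 * c * t)) := by
  have hpde : ∀ s d : ℝ, 0 < s → 0 < d → HasDerivAt (fun u => laplaceAt Q Y u d)
      (-(2 * (ν + 1) * d) * laplaceAt Q Y s d - 2 * d ^ 2 * laplaceAtDeriv Q Y s d) s := by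
    intro s d hs hd
    have hcont : Continuous fun u => -(2 * (ν + 1) * d) * laplaceAt Q Y u d
        - 2 * d ^ 2 * laplaceAtDeriv Q Y u d := by
      have e : Continuous fun u : ℝ => (u, d) := by fun_prop
      have c1 : Continuous fun u => laplaceAt Q Y u d := continuous_iff_continuousAt.2 fun u =>
        (continuousAt_laplaceAt hm hc h0 u hd).comp (f := fun u : ℝ => (u, d)) e.continuousAt
      have c2 : Continuous fun u => laplaceAtDeriv Q Y u d := continuous_iff_continuousAt.2
        fun u => (continuousAt_laplaceAtDeriv hm hc h0 u hd).comp (f := fun u : ℝ => (u, d))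
          e.continuousAt
      fun_prop
    have h1 := (intervalIntegral.integral_hasDerivAt_right (hcont.intervalIntegrable 0 s)
      hcont.stronglyMeasurable.stronglyMeasurableAtFilter hcont.continuousAt).const_add
        (laplaceAt Q Y 0 d)
    refine h1.congr_of_eventuallyEq ?_
    filter_upwards [lt_mem_nhds hs] with u hu
    exact laplaceAt_eq_add_integral hm hc h0 hQ hd hu.le
  -- The characteristic that ends at `c` at time `t` is `s ↦ c / D s`, and `D s ^ (-(ν + 1))` is the
  -- integrating factor for the zeroth-order term.
  let D : ℝ → ℝ := fun s => 1 + 2 * c * (t - s)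
  have hD : ∀ s, s ≤ t → 1 ≤ D s := fun s hs => by
    have : 0 ≤ 2 * c * (t - s) := by have := sub_nonneg.2 hs; positivity
    simp only [D]; linarith
  have hDd : ∀ s, HasDerivAt D (-(2 * c)) s := fun s => by
    have := (((hasDerivAt_id s).const_sub t).const_mul (2 * c)).const_add 1
    simpa [D] using this
  let F : ℝ → ℝ := fun s => D s ^ (-(ν + 1)) * laplaceAt Q Y s (c / D s)
  have hFc : ContinuousOn F (Icc 0 t) := by
    intro s hs
    have hDs : D s ≠ 0 := by linarith [hD s hs.2]
    have hDp : 0 < c / D s := div_pos hcp (by linarith [hD s hs.2])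
    refine ContinuousAt.continuousWithinAt (ContinuousAt.mul ?_ ?_)
    · exact (hDd s).continuousAt.rpow_const (Or.inl hDs)
    · exact (continuousAt_laplaceAt hm hc h0 s hDp).comp (f := fun s : ℝ => (s, c / D s))
        (continuousAt_id.prodMk (continuousAt_const.div (hDd s).continuousAt hDs))
  have hFd : ∀ s ∈ Ioo 0 t, HasDerivAt F 0 s := by
    intro s hs
    have hD1 := hD s hs.2.le
    have hD0 : 0 < D s := by linarith
    have hDp : 0 < c / D s := div_pos hcp hD0
    have hev : ∀ᶠ v : ℝ × ℝ in 𝓝 (s, c / D s), 0 < v.1 ∧ 0 < v.2 :=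
      ((continuous_fst.tendsto (s, c / D s)).eventually (lt_mem_nhds hs.1)).and
        ((continuous_snd.tendsto (s, c / D s)).eventually (lt_mem_nhds hDp))
    have hca := continuousAt_laplaceAt (Q := Q) hm hc h0 s hDp
    have hcb := continuousAt_laplaceAtDeriv (Q := Q) hm hc h0 s hDp
    -- Continuity of both partial derivatives gives joint differentiability, needed for the chain
    -- rule along the characteristic.
    have hfd := (hasStrictFDerivAt_uncurry_coprod (𝕜 := ℝ) (u := (s, c / D s))
      (f := laplaceAt Q Y)
      (f₁ := fun s d => (ContinuousLinearMap.toSpanSingleton ℝ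
        (-(2 * (ν + 1) * d) * laplaceAt Q Y s d - 2 * d ^ 2 * laplaceAtDeriv Q Y s d)))
      (f₂ := fun s d => (ContinuousLinearMap.toSpanSingleton ℝ (laplaceAtDeriv Q Y s d)))
      (hev.mono fun v hv => (hpde v.1 v.2 hv.1 hv.2).hasFDerivAt)
      (hev.mono fun v hv => (hasDerivAt_laplaceAt hm h0 v.1 hv.2).hasFDerivAt)
      ?_ ?_).hasFDerivAt
    rotate_left
    · refine (ContinuousLinearMap.toSpanSingletonCLE (𝕜 := ℝ) (E := ℝ)).continuous.continuousAt.comp ?_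
      change ContinuousAt (fun v : ℝ × ℝ => -(2 * (ν + 1) * v.2) * laplaceAt Q Y v.1 v.2
        - 2 * v.2 ^ 2 * laplaceAtDeriv Q Y v.1 v.2) _
      fun_prop
    · refine (ContinuousLinearMap.toSpanSingletonCLE (𝕜 := ℝ) (E := ℝ)).continuous.continuousAt.comp ?_
      exact hcb
    -- The curve `γ = c / D` satisfies `γ' = 2γ²`, so its contribution cancels the term `-2γ² ∂_c
    -- φ`.
    have hpath : HasDerivAt (fun s => (s, c / D s)) ((1 : ℝ), 2 * (c / D s) ^ 2) s := by
      refine (hasDerivAt_id s).prodMk ?_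
      convert! (hasDerivAt_const s c).div (hDd s) hD0.ne' using 1
      field_simp
      ring
    have hcomp := hfd.comp_hasDerivAt s hpath
    have hpow := (hDd s).rpow_const (p := -(ν + 1)) (Or.inl hD0.ne')
    refine (hpow.mul hcomp).congr_deriv ?_
    rw [Real.rpow_sub_one hD0.ne']
    simp [Function.HasUncurry.uncurry]
    field_simp
    ring
  obtain ⟨s, hs, hs'⟩ := exists_hasDerivAt_eq_slope F (fun _ => 0) ht hFc hFd
  have hF : F t = F 0 := by
    rw [eq_div_iff (by linarith)] at hs'
    linarith
  simpa [F, D] using hF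

end Laplace

/-! ### The transition density as a Poisson mixture of gamma laws. -/

noncomputable section

/-- The Poisson weight `exp (-rz) (rz)^k / k!`, as a function of `z`. -/
def poissonWeight (r : ℝ) (k : ℕ) (z : ℝ) : ℝ := Real.exp (-(r * z)) * (r * z) ^ k / k !

theorem poissonWeight_nonneg {r z : ℝ} (hr : 0 < r) (hz : 0 ≤ z) (k : ℕ) :
    0 ≤ poissonWeight r k z := by
  unfold poissonWeight; positivity

@[fun_prop]
theorem measurable_poissonWeight (r : ℝ) (k : ℕ) : Measurable (poissonWeight r k) := by
  unfold poissonWeight; fun_prop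

/-- The generating function of the Poisson law: `s = 1` bounds the weights, and `s = r/(r+c)` yields
the Laplace transform of the mixture. -/
theorem hasSum_poissonWeight_mul_pow (r z s : ℝ) :
    HasSum (fun k => poissonWeight r k z * s ^ k) (Real.exp (-(r * z)) * Real.exp (r * z * s)) := by
  have h := (NormedSpace.expSeries_div_hasSum_exp (𝔸 := ℝ) (r * z * s)).mul_left
    (Real.exp (-(r * z)))
  rw [← Real.exp_eq_exp_ℝ] at h
  refine h.congr_fun fun k => ?_
  unfold poissonWeight
  ring

theorem poissonWeight_le_one {r z : ℝ} (hr : 0 < r) (hz : 0 ≤ z) (k : ℕ) :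
    poissonWeight r k z ≤ 1 := by
  have h := hasSum_poissonWeight_mul_pow r z 1
  simp only [one_pow, mul_one, ← Real.exp_add, neg_add_cancel, Real.exp_zero] at h
  exact le_hasSum h k fun j _ => poissonWeight_nonneg hr hz j

/-- The transition density of the squared Bessel process of index `ν` at time `1 / (2r)`, as a
Poisson mixture of gamma densities. -/
def besqDensity (ν r z x : ℝ) : ℝ≥0∞ :=
  ∑' k : ℕ, ENNReal.ofReal (poissonWeight r k z) * gammaPDF (k + ν + 1) r x

theorem measurable_gammaPDF (a r : ℝ) : Measurable (gammaPDF a r) :=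
  (measurable_gammaPDFReal a r).ennreal_ofReal

@[fun_prop]
theorem measurable_besqDensity_comp {α : Type*} [MeasurableSpace α] (ν r : ℝ) {f g : α → ℝ}
    (hf : Measurable f) (hg : Measurable g) :
    Measurable fun a => besqDensity ν r (f a) (g a) := by
  unfold besqDensity
  refine Measurable.tsum fun k => ?_
  exact (((measurable_poissonWeight r k).comp hf).ennreal_ofReal).mul
    ((measurable_gammaPDF (k + ν + 1) r).comp hg)

theorem ofReal_exp_mul_gammaPDF {a r c x : ℝ} (hr : 0 < r) (hc : 0 ≤ c) :
    ENNReal.ofReal (Real.exp (-(c * x))) * gammaPDF a r x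
      = ENNReal.ofReal ((r / (r + c)) ^ a) * gammaPDF a (r + c) x := by
  rw [gammaPDF, gammaPDF, ← ENNReal.ofReal_mul (Real.exp_pos _).le,
    ← ENNReal.ofReal_mul (by positivity)]
  congr 1
  unfold gammaPDFReal
  split_ifs
  · have h : (r + c) ^ a ≠ 0 := (Real.rpow_pos_of_pos (by linarith) _).ne'
    rw [Real.div_rpow hr.le (by linarith), show -((r + c) * x) = -(r * x) + -(c * x) by ring,
      Real.exp_add]
    field_simp
  · simp

/-- The `k`-th gamma law contributes `(r/(r+c))^(k+ν+1)`; summing over `k` is the Poisson generating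
function at `r/(r+c)`. -/
theorem lintegral_exp_mul_besqDensity {ν r c z : ℝ} (hν : 0 < ν) (hr : 0 < r) (hc : 0 ≤ c)
    (hz : 0 ≤ z) :
    ∫⁻ x, ENNReal.ofReal (Real.exp (-(c * x))) * besqDensity ν r z x =
      ENNReal.ofReal ((r / (r + c)) ^ (ν + 1) * Real.exp (-(c * r / (r + c) * z))) := by
  have hrc : 0 < r / (r + c) := by positivity
  have hk : ∀ k : ℕ, ∫⁻ x, ENNReal.ofReal (Real.exp (-(c * x))) *
      (ENNReal.ofReal (poissonWeight r k z) * gammaPDF (k + ν + 1) r x) =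
      ENNReal.ofReal ((r / (r + c)) ^ (ν + 1) * (poissonWeight r k z * (r / (r + c)) ^ k)) := by
    intro k
    simp_rw [mul_left_comm _ (ENNReal.ofReal (poissonWeight r k z)),
      ofReal_exp_mul_gammaPDF hr hc]
    rw [lintegral_const_mul _ ((measurable_gammaPDF _ _).const_mul _),
      lintegral_const_mul _ (measurable_gammaPDF _ _),
      lintegral_gammaPDF_eq_one (by positivity) (by positivity), mul_one,
      ← ENNReal.ofReal_mul (poissonWeight_nonneg hr hz k), add_assoc, Real.rpow_add hrc,
      Real.rpow_natCast]
    congr 1; ring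
  simp_rw [besqDensity, ← ENNReal.tsum_mul_left]
  rw [lintegral_tsum fun k => by
    have := measurable_gammaPDF (k + ν + 1) r
    fun_prop]
  simp_rw [hk]
  have hs := (hasSum_poissonWeight_mul_pow r z (r / (r + c))).mul_left ((r / (r + c)) ^ (ν + 1))
  rw [← ENNReal.ofReal_tsum_of_nonneg (fun k => by
    have := poissonWeight_nonneg hr hz k
    positivity) hs.summable, hs.tsum_eq, ← Real.exp_add]
  congr 3
  field_simp
  ring

variable {Ω : Type*} {mΩ : MeasurableSpace Ω} {P : Measure Ω} [IsProbabilityMeasure P]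
  {ℱ : Filtration ℝ≥0 mΩ} {X : ℝ≥0 → Ω → ℝ}

omit [IsProbabilityMeasure P] in
theorem IsNonnegSDESolution.measurable {b σ : ℝ → ℝ} (h : IsNonnegSDESolution b σ ℱ P X)
    (t : ℝ≥0) : Measurable (X t) :=
  ((h.adapted t).mono (ℱ.le t)).measurable

/-- The joint Laplace transform identity of a squared Bessel process, restricted to an event
of the initial σ-algebra. -/
theorem IsBESQ.setIntegral_exp {ν : ℝ} (h : IsBESQ ν ℱ P X) {A : Set Ω}
    (hA : MeasurableSet[ℱ 0] A) {c : ℝ} (hc : 0 ≤ c) {t : ℝ≥0} (ht : 0 < t) :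
    ∫ ω in A, Real.exp (-(c * X t ω)) ∂P =
      ∫ ω in A, (1 + 2 * c * t) ^ (-(ν + 1)) *
        Real.exp (-(c / (1 + 2 * c * t) * X 0 ω)) ∂P := by
  -- At `c = 0` both sides are the mass of `A`; the transport equation is only available for `c >
  -- 0`.
  rcases hc.eq_or_lt with rfl | hc
  · simp
  -- `X` is nonnegative only almost surely, while `laplaceAt_eq` asks for it everywhere.
  let Y : ℝ≥0 → Ω → ℝ := fun s ω => max (X s ω) 0
  have hXY : ∀ᵐ ω ∂(P.restrict A), ∀ s, Y s ω = X s ω := by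
    filter_upwards [ae_restrict_of_ae h.nonneg] with ω hω s using max_eq_left (hω s)
  have key := laplaceAt_eq (Q := P.restrict A) (Y := Y) (ν := ν)
    (fun s => (h.measurable s).max measurable_const)
    (fun ω => (h.continuous_paths ω).max continuous_const) (fun s ω => le_max_right _ _)
    (fun f hf hfs s => ?_) hc (t := t) (by exact_mod_cast ht)
  · unfold laplaceAt at key
    rw [integral_const_mul]
    refine (integral_congr_ae ?_).trans (key.trans (congrArg _ (integral_congr_ae ?_)))
    · filter_upwards [hXY] with ω hω
      rw [hω, Real.toNNReal_coe]
    · filter_upwards [hXY] with ω hω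
      rw [hω, Real.toNNReal_zero]
  -- The test martingale starts at `0` and `A` lies in `ℱ 0`, so its integral over `A` vanishes at
  -- all times.
  · have hmart := (h.martingale f hf hfs).setIntegral_eq (j := s) zero_le hA
    simp only [NNReal.coe_zero, intervalIntegral.integral_same, sub_self, integral_zero] at hmart
    refine Eq.trans (integral_congr_ae ?_) hmart.symm
    filter_upwards [hXY] with ω hω
    simp only [hω]

/-- Both sides have the same Laplace transform at the integers. Restricting to `X 0 ⁻¹' B` for every
`B` is what upgrades the marginal law to the joint one. -/
theorem IsBESQ.map_restrict_eq {ν : ℝ} (hν : 0 < ν) (h : IsBESQ ν ℱ P X) {t : ℝ≥0} (ht : 0 < t)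
    {B : Set ℝ} (hB : MeasurableSet B) :
    (P.restrict (X 0 ⁻¹' B)).map (X t) = volume.withDensity fun x =>
      ∫⁻ z in B, besqDensity ν (1 / (2 * t)) z x ∂(P.map (X 0)) := by
  have ht' : (0 : ℝ) < t := by exact_mod_cast ht
  set r : ℝ := 1 / (2 * t) with hr_def
  have hr : 0 < r := by positivity
  set μ₀ := P.map (X 0) with hμ₀
  have hm0 := h.measurable 0
  have hmt := h.measurable t
  have hpos : ∀ᵐ z ∂μ₀, 0 ≤ z := by
    refine (ae_map_iff (p := fun z => 0 ≤ z) hm0.aemeasurable measurableSet_Ici).2 ?_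
    filter_upwards [h.nonneg] with ω hω using hω 0
  have hmq' : Measurable fun p : ℝ × ℝ => besqDensity ν r p.2 p.1 := by fun_prop
  have hmρ : Measurable fun x => ∫⁻ z in B, besqDensity ν r z x ∂μ₀ :=
    Measurable.lintegral_prod_right' (ν := μ₀.restrict B) hmq'
  have hprob : IsProbabilityMeasure μ₀ := Measure.isProbabilityMeasure_map hm0.aemeasurable
  have hL : ∀ c : ℝ, 0 ≤ c → ∫⁻ x, ENNReal.ofReal (Real.exp (-(c * x))) *
      ∫⁻ z in B, besqDensity ν r z x ∂μ₀ = ∫⁻ z in B,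
        ENNReal.ofReal ((r / (r + c)) ^ (ν + 1) * Real.exp (-(c * r / (r + c) * z))) ∂μ₀ := by
    intro c hc
    have hme : Measurable fun x : ℝ => ENNReal.ofReal (Real.exp (-(c * x))) := by fun_prop
    have hmx : ∀ x, Measurable fun z => besqDensity ν r z x := fun x => by fun_prop
    simp_rw [← lintegral_const_mul _ (hmx _)]
    rw [lintegral_lintegral_swap]
    · refine lintegral_congr_ae ?_
      filter_upwards [ae_restrict_of_ae hpos] with z hz
      exact lintegral_exp_mul_besqDensity hν hr hc hz
    · exact ((hme.comp measurable_fst).mul hmq').aemeasurable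
  have hfin : IsFiniteMeasure (volume.withDensity fun x =>
      ∫⁻ z in B, besqDensity ν r z x ∂μ₀) := by
    -- The case `c = 0` of `hL` computes the total mass as `μ₀ B`.
    refine isFiniteMeasure_withDensity ?_
    have := hL 0 le_rfl
    simp only [zero_mul, neg_zero, Real.exp_zero, ENNReal.ofReal_one, one_mul, add_zero,
      div_self hr.ne', Real.one_rpow, mul_one, zero_div, lintegral_const] at this
    rw [this]
    exact measure_ne_top _ _
  refine measure_ext_of_laplace ?_ ?_ fun n => ?_
  · refine (ae_map_iff (p := fun z => 0 ≤ z) hmt.aemeasurable measurableSet_Ici).2 ?_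
    filter_upwards [ae_restrict_of_ae h.nonneg] with ω hω using hω t
  · rw [ae_withDensity_iff hmρ]
    refine ae_of_all _ fun x hx => ?_
    contrapose! hx
    simp [besqDensity, gammaPDF_of_neg hx]
  · have hme : Measurable fun x : ℝ => Real.exp (-(n * x)) := by fun_prop
    have hn : (0 : ℝ) ≤ n := n.cast_nonneg
    have hA : MeasurableSet[ℱ 0] (X 0 ⁻¹' B) := (h.adapted 0).measurable hB
    rw [integral_map hmt.aemeasurable hme.aestronglyMeasurable, h.setIntegral_exp hA hn ht,
      integral_eq_lintegral_of_nonneg_ae (μ := volume.withDensity _)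
        (ae_of_all _ fun _ => (Real.exp_pos _).le) hme.aestronglyMeasurable,
      lintegral_withDensity_eq_lintegral_mul _ hmρ hme.ennreal_ofReal]
    simp only [Pi.mul_apply]
    simp_rw [mul_comm (∫⁻ z in B, besqDensity ν r z _ ∂μ₀)]
    rw [hL n hn, ← integral_eq_lintegral_of_nonneg_ae (ae_of_all _ fun z => by positivity)
      (by fun_prop), hμ₀, setIntegral_map hB (by fun_prop) hm0.aemeasurable]
    refine integral_congr_ae (ae_of_all _ fun ω => ?_)
    have e1 : r / (r + n) = (1 + 2 * n * (t : ℝ))⁻¹ := by rw [hr_def]; field_simp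
    have e2 : (n : ℝ) * r / (r + n) = n / (1 + 2 * n * (t : ℝ)) := by rw [hr_def]; field_simp
    simp only [e1, e2]
    rw [Real.inv_rpow (by positivity), Real.rpow_neg (by positivity)]

theorem IsBESQ.joint_law {ν : ℝ} (hν : 0 < ν) (h : IsBESQ ν ℱ P X) {t : ℝ≥0} (ht : 0 < t) :
    P.map (fun ω => (X t ω, X 0 ω)) = (volume.prod (P.map (X 0))).withDensity
      fun p => besqDensity ν (1 / (2 * t)) p.2 p.1 := by
  have hm0 := h.measurable 0
  have hmt := h.measurable t
  have hprob : IsProbabilityMeasure (P.map (X 0)) :=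
    Measure.isProbabilityMeasure_map hm0.aemeasurable
  have hmq : Measurable fun p : ℝ × ℝ => besqDensity ν (1 / (2 * t)) p.2 p.1 := by fun_prop
  have : IsFiniteMeasure (P.map fun ω => (X t ω, X 0 ω)) := inferInstance
  refine Measure.ext_prod fun {s B} hs hB => ?_
  have h1 := congrArg (fun m : Measure ℝ => m s) (h.map_restrict_eq hν ht hB)
  rw [Measure.map_apply hmt hs, Measure.restrict_apply (hmt hs), withDensity_apply _ hs] at h1
  rw [Measure.map_apply (hmt.prodMk hm0) (hs.prod hB), mk_preimage_prod, h1,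
    withDensity_apply _ (hs.prod hB), ← Measure.prod_restrict, lintegral_prod _ hmq.aemeasurable]

end

/-! ### Entire series with coefficients bounded by `C M^k / k!`. -/

section PowerSeries

theorem summable_mul_pow_of_le_factorial {a : ℕ → ℝ} {C M : ℝ}
    (h : ∀ k, |a k| ≤ C * M ^ k / k !) (x : ℝ) : Summable fun k => a k * x ^ k := by
  refine Summable.of_norm_bounded ((Real.summable_pow_div_factorial (M * |x|)).mul_left C)
    fun k => ?_
  rw [norm_mul, norm_pow, Real.norm_eq_abs, Real.norm_eq_abs, mul_pow]
  calc |a k| * |x| ^ k ≤ C * M ^ k / k ! * |x| ^ k := by gcongr; exact h k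
    _ = _ := by ring

/-- The class of coefficient bounds is stable under termwise differentiation: `C` becomes `C M` and
`M` is unchanged. -/
theorem derivedCoeff_le_factorial {a : ℕ → ℝ} {C M : ℝ}
    (h : ∀ k, |a k| ≤ C * M ^ k / k !) (k : ℕ) :
    |((k : ℝ) + 1) * a (k + 1)| ≤ C * M * M ^ k / k ! := by
  rw [abs_mul, abs_of_pos (by positivity)]
  calc ((k : ℝ) + 1) * |a (k + 1)| ≤ (k + 1) * (C * M ^ (k + 1) / (k + 1)!) := by
        gcongr; exact h _
    _ = _ := by
        rw [Nat.factorial_succ]; push_cast; field_simp; ring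

/-- Termwise differentiation of an everywhere convergent power series. -/
theorem hasDerivAt_tsum_mul_pow {a : ℕ → ℝ} {C M : ℝ}
    (h : ∀ k, |a k| ≤ C * M ^ k / k !) (x : ℝ) :
    HasDerivAt (fun x => ∑' k, a k * x ^ k)
      (∑' k : ℕ, ((k : ℝ) + 1) * a (k + 1) * x ^ k) x := by
  set R := |x| + 1 with hR
  have hu : Summable fun n : ℕ => |a n| * (n * R ^ (n - 1)) := by
    rw [← summable_nat_add_iff 1]
    have := (summable_mul_pow_of_le_factorial (derivedCoeff_le_factorial h) R).abs
    refine this.congr fun k => ?_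
    rw [abs_mul, abs_mul, abs_of_pos (by positivity : (0 : ℝ) < (k : ℝ) + 1),
      abs_of_nonneg (by positivity : 0 ≤ R ^ k)]
    push_cast
    ring
  have hx : x ∈ Ioo (-R) R := abs_lt.1 (by rw [hR]; linarith)
  have key := hasDerivAt_tsum_of_isPreconnected (g := fun k x => a k * x ^ k)
    (g' := fun k x => a k * (k * x ^ (k - 1))) hu isOpen_Ioo isPreconnected_Ioo
    (fun k y _ => (hasDerivAt_pow k y).const_mul (a k)) (fun k y hy => ?_) hx
    (summable_mul_pow_of_le_factorial h x) hx
  · refine key.congr_deriv ?_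
    have hs : Summable fun k : ℕ => a k * (k * x ^ (k - 1)) := by
      rw [← summable_nat_add_iff 1]
      refine (summable_mul_pow_of_le_factorial (derivedCoeff_le_factorial h) x).congr
        fun k => ?_
      push_cast
      ring
    rw [hs.tsum_eq_zero_add]
    simp only [Nat.cast_zero, zero_mul, mul_zero, zero_add, add_tsub_cancel_right]
    refine tsum_congr fun k => ?_
    push_cast
    ring
  · rw [norm_mul, norm_mul, norm_pow, Real.norm_eq_abs, Real.norm_eq_abs, Real.norm_eq_abs,
      Nat.abs_cast]
    have : |y| ≤ R := (abs_lt.2 hy).le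
    gcongr

theorem contDiff_tsum_mul_pow {a : ℕ → ℝ} {C M : ℝ} (h : ∀ k, |a k| ≤ C * M ^ k / k !) :
    ContDiff ℝ (⊤ : ℕ∞) fun x => ∑' k, a k * x ^ k := by
  refine contDiff_infty.2 fun n => ?_
  -- The derivative is a series of the same class with other `a` and `C`, hence the generalisation.
  induction n generalizing a C with
  | zero =>
    exact contDiff_zero.2
      (continuous_iff_continuousAt.2 fun x => (hasDerivAt_tsum_mul_pow h x).continuousAt)
  | succ n ih =>
    have hd : deriv (fun x => ∑' k, a k * x ^ k) =
        fun x => ∑' k : ℕ, ((k : ℝ) + 1) * a (k + 1) * x ^ k :=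
      funext fun x => (hasDerivAt_tsum_mul_pow h x).deriv
    push_cast
    refine contDiff_succ_iff_deriv.2
      ⟨fun x => (hasDerivAt_tsum_mul_pow h x).differentiableAt, by simp, ?_⟩
    rw [hd]
    exact ih (derivedCoeff_le_factorial h)

end PowerSeries

/-! ### Bessel functions through their entire parts. -/

/-- `Γ(k+ν+1)` is `Γ(ν+1)` times the product of the `j + ν` for `1 ≤ j ≤ k`, and each factor is at
least `j`. -/
theorem factorial_mul_Gamma_le {ν : ℝ} (hν : 0 < ν) (k : ℕ) :
    (k ! : ℝ) * Real.Gamma (ν + 1) ≤ Real.Gamma (k + ν + 1) := by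
  induction k with
  | zero => simp
  | succ k ih =>
    have e : ((k + 1 : ℕ) : ℝ) + ν + 1 = (k + ν + 1) + 1 := by push_cast; ring
    have hG : 0 < Real.Gamma (k + ν + 1) := Real.Gamma_pos_of_pos (by positivity)
    rw [e, Real.Gamma_add_one (s := k + ν + 1) (by positivity), Nat.factorial_succ]
    push_cast
    calc ((k : ℝ) + 1) * k ! * Real.Gamma (ν + 1) = (k + 1) * (k ! * Real.Gamma (ν + 1)) := by ring
      _ ≤ (k + 1) * Real.Gamma (k + ν + 1) := by gcongr
      _ ≤ (k + ν + 1) * Real.Gamma (k + ν + 1) := by gcongr; linarith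

noncomputable section Bessel

/-- The entire part `∑ₖ y^k / (k! Γ(k+ν+1))` of the modified Bessel function. -/
def besselEntire (ν y : ℝ) : ℝ := ∑' k : ℕ, 1 / ((k ! : ℝ) * Real.Gamma (k + ν + 1)) * y ^ k

theorem besselEntire_coeff_le {ν : ℝ} (hν : 0 < ν) (k : ℕ) :
    |1 / ((k ! : ℝ) * Real.Gamma (k + ν + 1))| ≤ 1 / Real.Gamma (ν + 1) * 1 ^ k / k ! := by
  have hG : 0 < Real.Gamma (ν + 1) := Real.Gamma_pos_of_pos (by positivity)
  have hG' : 0 < Real.Gamma (k + ν + 1) := Real.Gamma_pos_of_pos (by positivity)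
  rw [abs_of_pos (by positivity), one_pow, mul_one, div_div, mul_comm (Real.Gamma (ν + 1))]
  have h1 : (1 : ℝ) ≤ k ! := by exact_mod_cast Nat.factorial_pos k
  have := factorial_mul_Gamma_le hν k
  gcongr
  nlinarith

theorem summable_besselEntire {ν : ℝ} (hν : 0 < ν) (y : ℝ) :
    Summable fun k : ℕ => 1 / ((k ! : ℝ) * Real.Gamma (k + ν + 1)) * y ^ k :=
  summable_mul_pow_of_le_factorial (besselEntire_coeff_le hν) y

theorem continuous_besselEntire {ν : ℝ} (hν : 0 < ν) : Continuous (besselEntire ν) :=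
  (contDiff_tsum_mul_pow (besselEntire_coeff_le hν)).continuous

theorem besselEntire_pos {ν y : ℝ} (hν : 0 < ν) (hy : 0 ≤ y) : 0 < besselEntire ν y := by
  have hG : ∀ k : ℕ, 0 < Real.Gamma (k + ν + 1) := fun k =>
    Real.Gamma_pos_of_pos (by positivity)
  refine (summable_besselEntire hν y).tsum_pos (fun k => ?_) 0 ?_
  · have := hG k; positivity
  · have := hG 0; simp only [pow_zero]; positivity

theorem besselI_eq_mul_besselEntire (ν : ℝ) {x : ℝ} (hx : 0 < x) :
    besselI ν x = (x / 2) ^ ν * besselEntire ν ((x / 2) ^ 2) := by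
  have h2 : 0 < x / 2 := by positivity
  rw [besselI, besselEntire, ← tsum_mul_left]
  refine tsum_congr fun k => ?_
  rw [Real.rpow_add h2, Real.rpow_mul h2.le, Real.rpow_natCast, Real.rpow_two]
  ring

/-- The powers `(·/2)^ν` cancel, leaving one factor from the order `ν + 1`. The resulting quotient
has a positive denominator, so it is also valid at `z = 0` and visibly measurable and nonnegative.
-/
theorem besqRatio_eq {ν t x z : ℝ} (ht : 0 < t) (hx : 0 < x) (hz : 0 ≤ z) :
    besqRatio ν t x z = z * √x * (1 / (2 * t)) *
      besselEntire (ν + 1) ((1 / (2 * t)) ^ 2 * x * z) /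
        besselEntire ν ((1 / (2 * t)) ^ 2 * x * z) := by
  rcases hz.eq_or_lt with rfl | hz
  · simp [besqRatio]
  have hy : 0 < √(x * z) / t := by positivity
  have h2 : 0 < √(x * z) / t / 2 := by positivity
  have hpow : (√(x * z) / t / 2) ^ ν ≠ 0 := (Real.rpow_pos_of_pos h2 _).ne'
  have e : (√(x * z) / t / 2) ^ 2 = (1 / (2 * t)) ^ 2 * x * z := by
    rw [div_pow, div_pow, Real.sq_sqrt (by positivity)]
    field_simp
  have e2 : √z * (√(x * z) / t / 2) = z * √x * (1 / (2 * t)) := by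
    rw [Real.sqrt_mul hx.le]
    nth_rewrite 3 [← Real.mul_self_sqrt hz.le]
    ring
  rw [besqRatio, besselI_eq_mul_besselEntire _ hy, besselI_eq_mul_besselEntire _ hy, e,
    Real.rpow_add_one h2.ne', ← e2]
  field_simp

end Bessel

noncomputable section

/-! ### Bayes' formula for the conditional law of the initial value. -/

section Disintegration

/-- The marginal density `∫ q(z, x) μ₀(dz)`. -/
def mixedDensity (μ₀ : Measure ℝ) (q : ℝ → ℝ → ℝ≥0∞) (x : ℝ) : ℝ≥0∞ := ∫⁻ z, q z x ∂μ₀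

/-- Bayes' formula: the posterior law of the initial value, with density `q(z, x) / p(x)` with
respect to the prior `μ₀`. -/
def posteriorKernel (μ₀ : Measure ℝ) [SFinite μ₀] (q : ℝ → ℝ → ℝ≥0∞) : Kernel ℝ ℝ :=
  Kernel.withDensity (Kernel.const ℝ μ₀) fun x z => q z x / mixedDensity μ₀ q x

variable {μ₀ : Measure ℝ} [IsProbabilityMeasure μ₀] {q : ℝ → ℝ → ℝ≥0∞}

theorem measurable_mixedDensity (hq : Measurable fun p : ℝ × ℝ => q p.2 p.1) :
    Measurable (mixedDensity μ₀ q) :=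
  Measurable.lintegral_prod_right' (ν := μ₀) hq

theorem measurable_posterior_density (hq : Measurable fun p : ℝ × ℝ => q p.2 p.1) :
    Measurable (Function.uncurry fun x z => q z x / mixedDensity μ₀ q x) :=
  hq.div ((measurable_mixedDensity hq).comp measurable_fst)

theorem posteriorKernel_apply (hq : Measurable fun p : ℝ × ℝ => q p.2 p.1) (x : ℝ) :
    posteriorKernel μ₀ q x = μ₀.withDensity fun z => q z x / mixedDensity μ₀ q x := by
  rw [posteriorKernel, Kernel.withDensity_apply _ (measurable_posterior_density hq),
    Kernel.const_apply]

theorem measurable_section (hq : Measurable fun p : ℝ × ℝ => q p.2 p.1) (x : ℝ) :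
    Measurable fun z => q z x :=
  hq.comp measurable_prodMk_left

theorem isFiniteKernel_posteriorKernel (hq : Measurable fun p : ℝ × ℝ => q p.2 p.1) :
    IsFiniteKernel (posteriorKernel μ₀ q) := by
  refine ⟨1, ENNReal.one_lt_top, fun x => ?_⟩
  rw [posteriorKernel_apply hq, withDensity_apply _ MeasurableSet.univ, Measure.restrict_univ]
  simp_rw [div_eq_mul_inv]
  rw [lintegral_mul_const _ (measurable_section hq x)]
  -- The mass is `p(x) / p(x)`, which is `1` unless `p(x)` is `0` or `∞`, where it is `0`.
  exact ENNReal.div_self_le_one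

/-- If `(U, V)` has density `q(v, u)` with respect to `du μ₀(dv)`, then `U` has density
`∫ q(v, u) μ₀(dv)` and Bayes' formula gives the conditional law of `V` given `U`. -/
theorem map_eq_withDensity_mixedDensity {Ω : Type*} {mΩ : MeasurableSpace Ω} {P : Measure Ω}
    {U V : Ω → ℝ} (hU : Measurable U) (hV : Measurable V)
    (hq : Measurable fun p : ℝ × ℝ => q p.2 p.1)
    (h : P.map (fun ω => (U ω, V ω)) = (volume.prod μ₀).withDensity fun p => q p.2 p.1) :
    P.map U = volume.withDensity (mixedDensity μ₀ q) := by
  ext s hs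
  have h1 := congrArg (fun m : Measure (ℝ × ℝ) => m (s ×ˢ univ)) h
  rw [Measure.map_apply (hU.prodMk hV) (hs.prod MeasurableSet.univ), mk_preimage_prod,
    preimage_univ, inter_univ, ← Measure.map_apply hU hs,
    withDensity_apply _ (hs.prod MeasurableSet.univ), ← Measure.prod_restrict,
    lintegral_prod _ hq.aemeasurable, Measure.restrict_univ] at h1
  rw [h1, withDensity_apply _ hs]
  rfl

theorem condDistrib_ae_eq_posteriorKernel {Ω : Type*} {mΩ : MeasurableSpace Ω} {P : Measure Ω}
    [IsProbabilityMeasure P]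
    {U V : Ω → ℝ} (hU : Measurable U) (hV : Measurable V)
    (hq : Measurable fun p : ℝ × ℝ => q p.2 p.1)
    (h : P.map (fun ω => (U ω, V ω)) = (volume.prod μ₀).withDensity fun p => q p.2 p.1) :
    condDistrib V U P =ᵐ[P.map U] posteriorKernel μ₀ q := by
  have hfk := isFiniteKernel_posteriorKernel (μ₀ := μ₀) hq
  have hp := measurable_mixedDensity (μ₀ := μ₀) hq
  have hmU := map_eq_withDensity_mixedDensity hU hV hq h
  have hprob : IsProbabilityMeasure (P.map U) :=
    Measure.isProbabilityMeasure_map hU.aemeasurable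
  have hfin : ∀ᵐ x, mixedDensity μ₀ q x < ∞ := by
    refine ae_lt_top hp ?_
    have := measure_univ (μ := P.map U)
    rw [hmU, withDensity_apply _ MeasurableSet.univ, Measure.restrict_univ] at this
    rw [this]
    exact ENNReal.one_ne_top
  refine condDistrib_ae_eq_of_measure_eq_compProd_of_measurable hU hV ?_
  have : IsFiniteMeasure (P.map fun ω => (U ω, V ω)) := inferInstance
  refine Measure.ext_prod fun {s B} hs hB => ?_
  rw [Measure.compProd_apply_prod hs hB, h, withDensity_apply _ (hs.prod hB),
    ← Measure.prod_restrict, lintegral_prod _ hq.aemeasurable, hmU,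
    restrict_withDensity hs, lintegral_withDensity_eq_lintegral_mul _ hp
      (Kernel.measurable_coe _ hB)]
  refine lintegral_congr_ae ?_
  filter_upwards [ae_restrict_of_ae hfin] with x hx
  rw [Pi.mul_apply, posteriorKernel_apply hq, withDensity_apply _ hB]
  simp_rw [div_eq_mul_inv]
  rw [lintegral_mul_const _ (measurable_section hq x)]
  -- Where `p(x) = 0`, the integral of `q(·, x)` over `B` vanishes too, so the degenerate quotient
  -- does no harm.
  by_cases h0 : mixedDensity μ₀ q x = 0
  · rw [h0, zero_mul]
    refine le_antisymm ((lintegral_mono' Measure.restrict_le_self le_rfl).trans h0.le) zero_le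
  · rw [mul_comm, mul_assoc, ENNReal.inv_mul_cancel h0 hx.ne, mul_one]

end Disintegration

/-! ### The marginal density, its score and the posterior mean. -/

section Mixture

/-- The coefficients of the entire part of the density of a squared Bessel process. -/
def besqCoeff (ν r : ℝ) (μ₀ : Measure ℝ) (k : ℕ) : ℝ :=
  (∫ z, poissonWeight r k z ∂μ₀) * (r ^ ((k : ℝ) + ν + 1) / Real.Gamma (k + ν + 1))

/-- The density of a squared Bessel process at time `1 / (2r)` with initial law `μ₀`. -/
def besqMarginal (ν r : ℝ) (μ₀ : Measure ℝ) (x : ℝ) : ℝ :=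
  x ^ ν * Real.exp (-(r * x)) * ∑' k, besqCoeff ν r μ₀ k * x ^ k

variable {ν r : ℝ} {μ₀ : Measure ℝ} [IsProbabilityMeasure μ₀]

theorem integrable_poissonWeight (hr : 0 < r) (hμ : ∀ᵐ z ∂μ₀, 0 ≤ z) (k : ℕ) :
    Integrable (poissonWeight r k) μ₀ := by
  refine Integrable.of_bound (by fun_prop) 1 ?_
  filter_upwards [hμ] with z hz
  rw [Real.norm_of_nonneg (poissonWeight_nonneg hr hz k)]
  exact poissonWeight_le_one hr hz k

omit [IsProbabilityMeasure μ₀] in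
theorem integral_poissonWeight_nonneg (hr : 0 < r) (hμ : ∀ᵐ z ∂μ₀, 0 ≤ z) (k : ℕ) :
    0 ≤ ∫ z, poissonWeight r k z ∂μ₀ :=
  integral_nonneg_of_ae (hμ.mono fun _ hz => poissonWeight_nonneg hr hz k)

theorem integral_poissonWeight_le_one (hr : 0 < r) (hμ : ∀ᵐ z ∂μ₀, 0 ≤ z) (k : ℕ) :
    ∫ z, poissonWeight r k z ∂μ₀ ≤ 1 := by
  have := integral_mono_ae (integrable_poissonWeight hr hμ k) (integrable_const (1 : ℝ))
    (hμ.mono fun _ hz => poissonWeight_le_one hr hz k)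
  simpa using this

theorem lintegral_poissonWeight (hr : 0 < r) (hμ : ∀ᵐ z ∂μ₀, 0 ≤ z) (k : ℕ) :
    ∫⁻ z, ENNReal.ofReal (poissonWeight r k z) ∂μ₀ =
      ENNReal.ofReal (∫ z, poissonWeight r k z ∂μ₀) :=
  (ofReal_integral_eq_lintegral_ofReal (integrable_poissonWeight hr hμ k)
    (hμ.mono fun _ hz => poissonWeight_nonneg hr hz k)).symm

theorem Gamma_natCast_add_pos (hν : 0 < ν) (k : ℕ) : 0 < Real.Gamma (k + ν + 1) :=
  Real.Gamma_pos_of_pos (by positivity)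

omit [IsProbabilityMeasure μ₀] in
theorem besqCoeff_nonneg (hν : 0 < ν) (hr : 0 < r) (hμ : ∀ᵐ z ∂μ₀, 0 ≤ z) (k : ℕ) :
    0 ≤ besqCoeff ν r μ₀ k := by
  have := integral_poissonWeight_nonneg hr hμ k
  have := Gamma_natCast_add_pos hν k
  unfold besqCoeff
  positivity

theorem besqCoeff_le (hν : 0 < ν) (hr : 0 < r) (hμ : ∀ᵐ z ∂μ₀, 0 ≤ z) (k : ℕ) :
    |besqCoeff ν r μ₀ k| ≤ r ^ (ν + 1) / Real.Gamma (ν + 1) * r ^ k / k ! := by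
  rw [abs_of_nonneg (besqCoeff_nonneg hν hr hμ k), besqCoeff]
  have hG := Gamma_natCast_add_pos hν k
  have hG0 : 0 < Real.Gamma (ν + 1) := Real.Gamma_pos_of_pos (by positivity)
  have e : r ^ ((k : ℝ) + ν + 1) = r ^ (ν + 1) * r ^ k := by
    rw [add_assoc, Real.rpow_add hr, Real.rpow_natCast, mul_comm]
  calc _ ≤ 1 * (r ^ ((k : ℝ) + ν + 1) / Real.Gamma (k + ν + 1)) := by
        gcongr; exact integral_poissonWeight_le_one hr hμ k
    _ ≤ r ^ ((k : ℝ) + ν + 1) / (k ! * Real.Gamma (ν + 1)) := by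
        rw [one_mul]; gcongr; exact factorial_mul_Gamma_le hν k
    _ = _ := by rw [e]; field_simp

theorem besqCoeff_zero_pos (hν : 0 < ν) (hr : 0 < r) (hμ : ∀ᵐ z ∂μ₀, 0 ≤ z) :
    0 < besqCoeff ν r μ₀ 0 := by
  have e : poissonWeight r 0 = fun z => Real.exp (-(r * z)) := by
    ext z; simp [poissonWeight]
  have h := integrable_poissonWeight hr hμ 0
  rw [e] at h
  have hG := Gamma_natCast_add_pos hν 0
  rw [besqCoeff, e]
  exact mul_pos (integral_exp_pos h) (by positivity)

theorem tsum_besqCoeff_pos (hν : 0 < ν) (hr : 0 < r) (hμ : ∀ᵐ z ∂μ₀, 0 ≤ z) {x : ℝ}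
    (hx : 0 < x) : 0 < ∑' k, besqCoeff ν r μ₀ k * x ^ k := by
  refine (summable_mul_pow_of_le_factorial (besqCoeff_le hν hr hμ) x).tsum_pos (fun k => ?_) 0 ?_
  · have := besqCoeff_nonneg hν hr hμ k
    positivity
  · have := besqCoeff_zero_pos hν hr hμ
    simpa using this

theorem besqMarginal_pos (hν : 0 < ν) (hr : 0 < r) (hμ : ∀ᵐ z ∂μ₀, 0 ≤ z) {x : ℝ}
    (hx : 0 < x) : 0 < besqMarginal ν r μ₀ x := by
  have := tsum_besqCoeff_pos hν hr hμ hx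
  unfold besqMarginal
  positivity

theorem contDiffOn_besqMarginal (hν : 0 < ν) (hr : 0 < r) (hμ : ∀ᵐ z ∂μ₀, 0 ≤ z) :
    ContDiffOn ℝ (⊤ : ℕ∞) (besqMarginal ν r μ₀) (Ioi 0) := by
  have h := contDiff_tsum_mul_pow (besqCoeff_le hν hr hμ)
  refine ContDiffOn.mul (ContDiffOn.mul (fun x hx => ?_) ?_) h.contDiffOn
  · exact (Real.contDiffAt_rpow_const_of_ne (ne_of_gt hx)).contDiffWithinAt
  · exact ContDiff.contDiffOn (by fun_prop)

theorem hasDerivAt_log_besqMarginal (hν : 0 < ν) (hr : 0 < r) (hμ : ∀ᵐ z ∂μ₀, 0 ≤ z) {x : ℝ}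
    (hx : 0 < x) : HasDerivAt (fun y => Real.log (besqMarginal ν r μ₀ y))
      (ν / x - r + (∑' k : ℕ, ((k : ℝ) + 1) * besqCoeff ν r μ₀ (k + 1) * x ^ k) /
        ∑' k, besqCoeff ν r μ₀ k * x ^ k) x := by
  have h := hasDerivAt_tsum_mul_pow (besqCoeff_le hν hr hμ) x
  have h1 := ((((Real.hasDerivAt_log hx.ne').const_mul ν).sub
    ((hasDerivAt_id x).const_mul r)).add (h.log (tsum_besqCoeff_pos hν hr hμ hx).ne'))
  refine (h1.congr_of_eventuallyEq ?_).congr_deriv (by rw [mul_one]; rfl)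
  filter_upwards [lt_mem_nhds hx] with y hy
  have hp : 0 < y ^ ν := Real.rpow_pos_of_pos hy _
  rw [besqMarginal, Real.log_mul (by positivity) (tsum_besqCoeff_pos hν hr hμ hy).ne',
    Real.log_mul hp.ne' (Real.exp_pos _).ne', Real.log_exp, Real.log_rpow hy]
  simp [sub_eq_add_neg]

theorem gammaPDF_add_eq {x : ℝ} (hx : 0 < x) (k : ℕ) :
    gammaPDF (k + ν + 1) r x = ENNReal.ofReal
      (x ^ ν * Real.exp (-(r * x)) * (r ^ ((k : ℝ) + ν + 1) / Real.Gamma (k + ν + 1) * x ^ k)) := by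
  rw [gammaPDF_of_nonneg hx.le, add_sub_cancel_right, Real.rpow_add hx, Real.rpow_natCast]
  congr 1
  ring

theorem mixedDensity_besqDensity (hν : 0 < ν) (hr : 0 < r) (hμ : ∀ᵐ z ∂μ₀, 0 ≤ z) {x : ℝ}
    (hx : 0 < x) :
    mixedDensity μ₀ (besqDensity ν r) x = ENNReal.ofReal (besqMarginal ν r μ₀ x) := by
  unfold mixedDensity besqDensity besqMarginal
  rw [lintegral_tsum fun k => by fun_prop]
  have hk : ∀ k : ℕ, ∫⁻ z, ENNReal.ofReal (poissonWeight r k z) * gammaPDF (k + ν + 1) r x ∂μ₀ =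
      ENNReal.ofReal (x ^ ν * Real.exp (-(r * x)) * (besqCoeff ν r μ₀ k * x ^ k)) := by
    intro k
    rw [lintegral_mul_const _ (by fun_prop), lintegral_poissonWeight hr hμ, gammaPDF_add_eq hx,
      ← ENNReal.ofReal_mul (integral_poissonWeight_nonneg hr hμ k), besqCoeff]
    congr 1
    ring
  simp_rw [hk]
  rw [← tsum_mul_left, ENNReal.ofReal_tsum_of_nonneg (fun k => ?_)
    ((summable_mul_pow_of_le_factorial (besqCoeff_le hν hr hμ) x).mul_left _)]
  have := besqCoeff_nonneg hν hr hμ k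
  positivity

theorem withDensity_mixedDensity_besqDensity (hν : 0 < ν) (hr : 0 < r)
    (hμ : ∀ᵐ z ∂μ₀, 0 ≤ z) : volume.withDensity (mixedDensity μ₀ (besqDensity ν r)) =
      (volume.restrict (Ioi 0)).withDensity fun x => ENNReal.ofReal (besqMarginal ν r μ₀ x) := by
  rw [← withDensity_indicator measurableSet_Ioi]
  refine withDensity_congr_ae ?_
  filter_upwards [compl_mem_ae_iff.2 (measure_singleton (0 : ℝ))] with x hx
  rcases lt_or_gt_of_ne (show x ≠ 0 from hx) with h | h
  · rw [indicator_of_notMem (by simpa using h.le)]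
    simp [mixedDensity, besqDensity, gammaPDF_of_neg h]
  · rw [indicator_of_mem (show x ∈ Ioi 0 from h), mixedDensity_besqDensity hν hr hμ h]

theorem besqDensity_eq_besselEntire (hν : 0 < ν) (hr : 0 < r) {x z : ℝ} (hx : 0 < x)
    (hz : 0 ≤ z) : besqDensity ν r z x = ENNReal.ofReal
      (x ^ ν * Real.exp (-(r * x)) * (Real.exp (-(r * z)) * r ^ (ν + 1)) *
        besselEntire ν (r ^ 2 * x * z)) := by
  have hG := Gamma_natCast_add_pos hν
  rw [besselEntire, ← tsum_mul_left, ENNReal.ofReal_tsum_of_nonneg (fun k => by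
    have := hG k; positivity) ((summable_besselEntire hν _).mul_left _)]
  refine tsum_congr fun k => ?_
  rw [gammaPDF_add_eq hx, ← ENNReal.ofReal_mul (poissonWeight_nonneg hr hz k)]
  congr 1
  rw [add_assoc (k : ℝ) ν 1, Real.rpow_add hr, Real.rpow_natCast, poissonWeight]
  field_simp
  ring

/-- The entire part of `I_ν` in the density cancels the denominator of the ratio. What remains is
the series of `I_{ν+1}`, whose `k`-th term carries `z^(k+1)/k! = (k+1) z^(k+1)/(k+1)!`: a Poisson
weight of index `k + 1` with the factor `k + 1` of a derived series. -/
theorem besqDensity_mul_besqRatio (hν : 0 < ν) {t : ℝ} (ht : 0 < t) (hr : r = 1 / (2 * t))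
    {x z : ℝ} (hx : 0 < x) (hz : 0 ≤ z) :
    besqDensity ν r z x * ENNReal.ofReal (besqRatio ν t x z) =
      ∑' k : ℕ, ENNReal.ofReal (poissonWeight r (k + 1) z) *
        ENNReal.ofReal (√x / r * (x ^ ν * Real.exp (-(r * x))) * ((k + 1) *
          (r ^ (((k + 1 : ℕ) : ℝ) + ν + 1) / Real.Gamma ((k + 1 : ℕ) + ν + 1)) * x ^ k)) := by
  have hr0 : 0 < r := by rw [hr]; positivity
  have hν1 : 0 < ν + 1 := by linarith
  have hG := Gamma_natCast_add_pos hν1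
  have hH := besselEntire_pos hν (y := r ^ 2 * x * z) (by positivity)
  rw [besqRatio_eq ht hx hz, ← hr, besqDensity_eq_besselEntire hν hr0 hx hz,
    ← ENNReal.ofReal_mul (by positivity)]
  have e : x ^ ν * Real.exp (-(r * x)) * (Real.exp (-(r * z)) * r ^ (ν + 1)) *
      besselEntire ν (r ^ 2 * x * z) * (z * √x * r * besselEntire (ν + 1) (r ^ 2 * x * z) /
        besselEntire ν (r ^ 2 * x * z)) =
      x ^ ν * Real.exp (-(r * x)) * (Real.exp (-(r * z)) * r ^ (ν + 1)) * (z * √x * r) *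
        besselEntire (ν + 1) (r ^ 2 * x * z) := by
    field_simp
  rw [e, besselEntire, ← tsum_mul_left, ENNReal.ofReal_tsum_of_nonneg (fun k => by
    have := hG k; positivity) ((summable_besselEntire hν1 _).mul_left _)]
  refine tsum_congr fun k => ?_
  rw [← ENNReal.ofReal_mul (poissonWeight_nonneg hr0 hz _)]
  congr 1
  have e1 : ((k + 1 : ℕ) : ℝ) + ν + 1 = k + (ν + 1) + 1 := by push_cast; ring
  have e2 : (k : ℝ) + (ν + 1) + 1 = (k : ℝ) + ((ν + 1) + 1) := by ring
  have hGk := hG k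
  rw [e1]
  rw [show r ^ ((k : ℝ) + (ν + 1) + 1) = r ^ k * (r ^ (ν + 1) * r) by
    rw [e2, Real.rpow_add hr0, Real.rpow_natCast, Real.rpow_add_one hr0.ne'], poissonWeight,
    Nat.factorial_succ]
  push_cast
  field_simp
  ring

theorem lintegral_besqDensity_mul_besqRatio (hν : 0 < ν) {t : ℝ} (ht : 0 < t)
    (hr : r = 1 / (2 * t)) (hμ : ∀ᵐ z ∂μ₀, 0 ≤ z) {x : ℝ} (hx : 0 < x) :
    ∫⁻ z, besqDensity ν r z x * ENNReal.ofReal (besqRatio ν t x z) ∂μ₀ =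
      ENNReal.ofReal (√x / r * (x ^ ν * Real.exp (-(r * x))) *
        ∑' k : ℕ, ((k : ℝ) + 1) * besqCoeff ν r μ₀ (k + 1) * x ^ k) := by
  have hr0 : 0 < r := by rw [hr]; positivity
  rw [lintegral_congr_ae (hμ.mono fun z hz => besqDensity_mul_besqRatio hν ht hr hx hz),
    lintegral_tsum fun k => by fun_prop, ← tsum_mul_left,
    ENNReal.ofReal_tsum_of_nonneg (fun k => by
      have := besqCoeff_nonneg hν hr0 hμ (k + 1)
      positivity) ((summable_mul_pow_of_le_factorial
        (derivedCoeff_le_factorial (besqCoeff_le hν hr0 hμ)) x).mul_left _)]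
  refine tsum_congr fun k => ?_
  rw [lintegral_mul_const _ (by fun_prop), lintegral_poissonWeight hr0 hμ,
    ← ENNReal.ofReal_mul (integral_poissonWeight_nonneg hr0 hμ _), besqCoeff]
  congr 1
  ring

theorem besqRatio_nonneg (hν : 0 < ν) {t : ℝ} (ht : 0 < t) {x z : ℝ} (hx : 0 < x)
    (hz : 0 ≤ z) : 0 ≤ besqRatio ν t x z := by
  have h1 := besselEntire_pos hν (y := (1 / (2 * t)) ^ 2 * x * z) (by positivity)
  have h2 := besselEntire_pos (ν := ν + 1) (by linarith)
    (y := (1 / (2 * t)) ^ 2 * x * z) (by positivity)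
  rw [besqRatio_eq ht hx hz]
  positivity

/-- The posterior mean of the Bessel ratio is a logarithmic derivative. -/
theorem integral_besqRatio_posteriorKernel (hν : 0 < ν) {t : ℝ} (ht : 0 < t)
    (hr : r = 1 / (2 * t)) (hμ : ∀ᵐ z ∂μ₀, 0 ≤ z) {x : ℝ} (hx : 0 < x) :
    Integrable (besqRatio ν t x) (posteriorKernel μ₀ (besqDensity ν r) x) ∧
      ∫ z, besqRatio ν t x z ∂(posteriorKernel μ₀ (besqDensity ν r) x) =
        √x / r * ((∑' k : ℕ, ((k : ℝ) + 1) * besqCoeff ν r μ₀ (k + 1) * x ^ k) /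
          ∑' k, besqCoeff ν r μ₀ k * x ^ k) := by
  have hr0 : 0 < r := by rw [hr]; positivity
  have hν1 : 0 < ν + 1 := by linarith
  have hq : Measurable fun p : ℝ × ℝ => besqDensity ν r p.2 p.1 := by fun_prop
  have happ := posteriorKernel_apply (μ₀ := μ₀) hq x
  have hpos : ∀ᵐ z ∂(posteriorKernel μ₀ (besqDensity ν r) x), 0 ≤ z := by
    rw [happ]
    exact (withDensity_absolutelyContinuous _ _).ae_le hμ
  have hmeas : AEStronglyMeasurable (besqRatio ν t x)
      (posteriorKernel μ₀ (besqDensity ν r) x) := by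
    have h1 := (continuous_besselEntire hν).measurable
    have h2 := (continuous_besselEntire hν1).measurable
    refine AEStronglyMeasurable.congr (f := fun z => z * √x * (1 / (2 * t)) *
      besselEntire (ν + 1) ((1 / (2 * t)) ^ 2 * x * z) /
        besselEntire ν ((1 / (2 * t)) ^ 2 * x * z)) ?_
      (hpos.mono fun z hz => (besqRatio_eq ht hx hz).symm)
    exact Measurable.aestronglyMeasurable (by fun_prop)
  have hnn : 0 ≤ᵐ[posteriorKernel μ₀ (besqDensity ν r) x] besqRatio ν t x :=
    hpos.mono fun z hz => besqRatio_nonneg hν ht hx hz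
  have hS := tsum_besqCoeff_pos hν hr0 hμ hx
  have hp := besqMarginal_pos hν hr0 hμ hx
  have hlin : ∫⁻ z, ENNReal.ofReal (besqRatio ν t x z)
      ∂(posteriorKernel μ₀ (besqDensity ν r) x) = ENNReal.ofReal (√x / r *
        ((∑' k : ℕ, ((k : ℝ) + 1) * besqCoeff ν r μ₀ (k + 1) * x ^ k) /
          ∑' k, besqCoeff ν r μ₀ k * x ^ k)) := by
    have hmd : Measurable fun z => besqDensity ν r z x := by fun_prop
    have hae : AEMeasurable (fun z => ENNReal.ofReal (besqRatio ν t x z))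
        (μ₀.withDensity fun z => besqDensity ν r z x /
          mixedDensity μ₀ (besqDensity ν r) x) := happ ▸ hmeas.aemeasurable.ennreal_ofReal
    rw [happ, lintegral_withDensity_eq_lintegral_mul₀' (hmd.div_const _).aemeasurable hae]
    simp only [Pi.mul_apply]
    simp_rw [div_eq_mul_inv (besqDensity _ _ _ _), mul_right_comm (besqDensity _ _ _ _)]
    -- Positivity of the marginal at `x` makes its inverse a finite constant.
    rw [lintegral_mul_const' _ _ (by
        rw [mixedDensity_besqDensity hν hr0 hμ hx]
        simpa using hp),
      lintegral_besqDensity_mul_besqRatio hν ht hr hμ hx, mixedDensity_besqDensity hν hr0 hμ hx,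
      ← div_eq_mul_inv, ← ENNReal.ofReal_div_of_pos hp, besqMarginal]
    have hx1 : x ^ ν ≠ 0 := (Real.rpow_pos_of_pos hx _).ne'
    congr 1
    field_simp
  refine ⟨⟨hmeas, ?_⟩, ?_⟩
  · rw [hasFiniteIntegral_iff_ofReal hnn, hlin]
    exact ENNReal.ofReal_lt_top
  · rw [integral_eq_lintegral_of_nonneg_ae hnn hmeas, hlin, ENNReal.toReal_ofReal]
    have : 0 ≤ ∑' k : ℕ, ((k : ℝ) + 1) * besqCoeff ν r μ₀ (k + 1) * x ^ k :=
      tsum_nonneg fun k => by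
        have := besqCoeff_nonneg hν hr0 hμ (k + 1)
        positivity
    positivity

end Mixture

end

/-! ### The score formula and the scaling of space. -/

section Main

variable {Ω : Type*} {mΩ : MeasurableSpace Ω} {P : Measure Ω} [IsProbabilityMeasure P]
  {ℱ : Filtration ℝ≥0 mΩ} {X : ℝ≥0 → Ω → ℝ}

/-- The density of a squared Bessel process and Tweedie's formula for its score. -/
theorem IsBESQ.exists_density_score {ν : ℝ} (hν : 0 < ν) (h : IsBESQ ν ℱ P X) {t : ℝ≥0}
    (ht : 0 < t) : ∃ p : ℝ → ℝ, IsSmoothPosDensity (P.map (X t)) p ∧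
      ∀ᵐ x ∂(volume.restrict (Ioi (0 : ℝ))),
        Integrable (besqRatio ν t x) (condDistrib (X 0) (X t) P x) ∧
        HasDerivAt (fun y => Real.log (p y)) (besqTweedie ν P X t x) x := by
  have ht' : (0 : ℝ) < t := by exact_mod_cast ht
  have hm0 := h.measurable 0
  have hmt := h.measurable t
  have hprob : IsProbabilityMeasure (P.map (X 0)) :=
    Measure.isProbabilityMeasure_map hm0.aemeasurable
  have hr : (0 : ℝ) < 1 / (2 * t) := by positivity
  have hμ : ∀ᵐ z ∂(P.map (X 0)), 0 ≤ z := by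
    refine (ae_map_iff (p := fun z => 0 ≤ z) hm0.aemeasurable measurableSet_Ici).2 ?_
    filter_upwards [h.nonneg] with ω hω using hω 0
  have hq : Measurable fun p : ℝ × ℝ => besqDensity ν (1 / (2 * t)) p.2 p.1 := by fun_prop
  have hj := h.joint_law hν ht
  have hlaw := (map_eq_withDensity_mixedDensity hmt hm0 hq hj).trans
    (withDensity_mixedDensity_besqDensity hν hr hμ)
  have hcond := condDistrib_ae_eq_posteriorKernel hmt hm0 hq hj
  refine ⟨besqMarginal ν (1 / (2 * t)) (P.map (X 0)),
    ⟨hlaw, fun x hx => besqMarginal_pos hν hr hμ hx, contDiffOn_besqMarginal hν hr hμ⟩, ?_⟩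
  have hmp : AEMeasurable (fun x => ENNReal.ofReal (besqMarginal ν (1 / (2 * t)) (P.map (X 0)) x))
      (volume.restrict (Ioi (0 : ℝ))) :=
    ((contDiffOn_besqMarginal hν hr hμ).continuousOn.aemeasurable measurableSet_Ioi).ennreal_ofReal
  -- The density is positive on `(0, ∞)`, so "almost every" for the law of `X_t` becomes Lebesgue
  -- almost every there.
  rw [Filter.EventuallyEq, hlaw, ae_withDensity_iff' hmp] at hcond
  filter_upwards [hcond, ae_restrict_mem measurableSet_Ioi] with x hx hx0
  have hx0' : 0 < x := hx0
  have hxe := hx (by simpa using besqMarginal_pos hν hr hμ hx0')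
  obtain ⟨hi, he⟩ := integral_besqRatio_posteriorKernel hν ht' rfl hμ hx0'
  -- With `r = 1/(2t)`, the prefactor `1/(2t√x)` cancels `√x/r` and leaves `S'/S`.
  rw [besqTweedie, hxe, he]
  refine ⟨hi, (hasDerivAt_log_besqMarginal hν hr hμ hx0').congr_deriv ?_⟩
  have : √x ≠ 0 := (Real.sqrt_pos.2 hx0').ne'
  field_simp

theorem deriv_comp_const_mul (c : ℝ) (f : ℝ → ℝ) :
    deriv (fun x => f (c * x)) = fun x => c * deriv f (c * x) := by
  ext x
  simpa using deriv_comp_mul_left c f x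

omit [IsProbabilityMeasure P] in
/-- A constant multiple of a solution of `dX = μ dt + σ √X dW` is a squared Bessel process. -/
theorem IsNonnegSDESolution.isBESQ_const_mul {μ σ : ℝ} (hσ : 0 < σ)
    (h : IsNonnegSDESolution (fun _ => μ) (fun x => σ * √x) ℱ P X) :
    IsBESQ (2 * μ / σ ^ 2 - 1) ℱ P (fun s ω => 4 / σ ^ 2 * X s ω) := by
  have hc : 0 < 4 / σ ^ 2 := by positivity
  refine ⟨fun t => (h.adapted t).const_mul _, fun ω => (h.continuous_paths ω).const_mul _, ?_,
    fun f hf hfs => ?_⟩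
  · filter_upwards [h.nonneg] with ω hω t using mul_nonneg hc.le (hω t)
  · have hg : ContDiff ℝ (⊤ : ℕ∞) fun x => f (4 / σ ^ 2 * x) := hf.comp (by fun_prop)
    have hgs : HasCompactSupport fun x => f (4 / σ ^ 2 * x) :=
      hfs.comp_homeomorph (Homeomorph.mulLeft₀ _ hc.ne')
    have hgen : ∀ x, sdeGenerator (fun _ => μ) (fun x => σ * √x) (fun x => f (4 / σ ^ 2 * x)) x =
        sdeGenerator (fun _ => 2 * (2 * μ / σ ^ 2 - 1 + 1)) (fun x => 2 * √x) f
          (4 / σ ^ 2 * x) := by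
      intro x
      have e : deriv (fun x => 4 / σ ^ 2 * deriv f (4 / σ ^ 2 * x)) x =
          4 / σ ^ 2 * (4 / σ ^ 2 * deriv (deriv f) (4 / σ ^ 2 * x)) := by
        rw [deriv_const_mul_field, deriv_comp_const_mul]
      have e2 : √(4 / σ ^ 2 * x) ^ 2 = 4 / σ ^ 2 * √x ^ 2 := by
        rw [Real.sqrt_mul hc.le, mul_pow, Real.sq_sqrt hc.le]
      simp only [sdeGenerator, deriv_comp_const_mul, e, mul_pow, e2]
      field_simp
      ring
    have := h.martingale _ hg hgs
    simp_rw [hgen] at this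
    exact this

/-- Smooth positive densities under scaling. -/
theorem IsSmoothPosDensity.of_const_mul {m : Measure ℝ} {p : ℝ → ℝ} {c : ℝ} (hc : 0 < c)
    (h : IsSmoothPosDensity (m.map fun x => c * x) p) :
    IsSmoothPosDensity m fun x => c * p (c * x) := by
  have hmc : Measurable fun x : ℝ => c * x := by fun_prop
  have hmaps : MapsTo (fun x : ℝ => c * x) (Ioi 0) (Ioi 0) := fun x hx => mul_pos hc hx
  refine ⟨?_, fun x hx => mul_pos hc (h.pos _ (mul_pos hc hx)),
    contDiffOn_const.mul (h.smooth.comp (by fun_prop) hmaps)⟩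
  ext s hs
  have hci : Measurable fun x : ℝ => c⁻¹ * x := by fun_prop
  have hpre : (fun x : ℝ => c * x) ⁻¹' ((fun x : ℝ => c⁻¹ * x) ⁻¹' s) = s := by
    ext x
    simp [hc.ne']
  -- The law is evaluated on the dilated set `c • s`, whose preimage is `s`; the change of variables
  -- then produces the factor `c`.
  have h1 := congrArg (fun m : Measure ℝ => m ((fun x : ℝ => c⁻¹ * x) ⁻¹' s)) h.law
  rw [Measure.map_apply hmc (hci hs), hpre, withDensity_apply _ (hci hs),
    Measure.restrict_restrict (hci hs)] at h1
  rw [h1, withDensity_apply _ hs, Measure.restrict_restrict hs]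
  have himg : (fun x : ℝ => c * x) '' (s ∩ Ioi 0) = (fun x : ℝ => c⁻¹ * x) ⁻¹' s ∩ Ioi 0 := by
    ext y
    constructor
    · rintro ⟨x, ⟨hx, hx0⟩, rfl⟩
      exact ⟨by simpa [hc.ne'] using hx, mul_pos hc hx0⟩
    · rintro ⟨hy, hy0⟩
      exact ⟨c⁻¹ * y, ⟨hy, mul_pos (inv_pos.2 hc) hy0⟩, by field_simp⟩
  rw [← himg, lintegral_image_eq_lintegral_abs_deriv_mul (hs.inter measurableSet_Ioi)
    (f' := fun _ => c) (fun x _ => by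
      simpa using ((hasDerivAt_id x).const_mul c).hasDerivWithinAt)
    ((mul_right_injective₀ hc.ne').injOn)]
  simp_rw [abs_of_pos hc, ENNReal.ofReal_mul hc.le]

end Main

theorem mainTheorem3 {Ω : Type*} {mΩ : MeasurableSpace Ω} (P : Measure Ω) [IsProbabilityMeasure P]
    (ℱ : Filtration ℝ≥0 mΩ) (X : ℝ≥0 → Ω → ℝ) :
    (∀ ν : ℝ, 0 < ν → IsBESQ ν ℱ P X →
      ∀ t : ℝ≥0, 0 < t → ∃ p : ℝ → ℝ, IsSmoothPosDensity (P.map (X t)) p ∧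
        ∀ᵐ x ∂(volume.restrict (Ioi (0 : ℝ))),
          Integrable (besqRatio ν t x) (condDistrib (X 0) (X t) P x) ∧
          HasDerivAt (fun y => Real.log (p y)) (besqTweedie ν P X t x) x) ∧
    (∀ μ σ : ℝ, 0 < σ → σ ^ 2 / 2 < μ →
      IsNonnegSDESolution (fun _ => μ) (fun x => σ * √x) ℱ P X →
      IsBESQ (2 * μ / σ ^ 2 - 1) ℱ P (fun s ω => 4 / σ ^ 2 * X s ω) ∧
      ∀ t : ℝ≥0, 0 < t → ∃ p : ℝ → ℝ, IsSmoothPosDensity (P.map (X t)) p ∧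
        ∀ᵐ x ∂(volume.restrict (Ioi (0 : ℝ))),
          Integrable (besqRatio (2 * μ / σ ^ 2 - 1) t (4 / σ ^ 2 * x))
            (condDistrib (fun ω => 4 / σ ^ 2 * X 0 ω) (fun ω => 4 / σ ^ 2 * X t ω) P
              (4 / σ ^ 2 * x)) ∧
          HasDerivAt (fun y => Real.log (p y))
            (4 / σ ^ 2 * besqTweedie (2 * μ / σ ^ 2 - 1) P (fun s ω => 4 / σ ^ 2 * X s ω) t
              (4 / σ ^ 2 * x)) x) := by
  refine ⟨fun ν hν h t ht => h.exists_density_score hν ht, fun μ σ hσ hμ h => ?_⟩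
  have hZ := h.isBESQ_const_mul hσ
  refine ⟨hZ, fun t ht => ?_⟩
  have hc : 0 < 4 / σ ^ 2 := by positivity
  have hν : 0 < 2 * μ / σ ^ 2 - 1 := by
    rw [sub_pos, one_lt_div (by positivity)]
    linarith
  obtain ⟨p, hp, hscore⟩ := hZ.exists_density_score hν ht
  have hmap : P.map (fun ω => 4 / σ ^ 2 * X t ω) =
      (P.map (X t)).map fun x => 4 / σ ^ 2 * x :=
    (Measure.map_map (by fun_prop) (h.measurable t)).symm
  rw [hmap] at hp
  refine ⟨_, hp.of_const_mul hc, ?_⟩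
  rw [ae_restrict_iff' measurableSet_Ioi] at hscore ⊢
  -- Dilations pull null sets back to null sets, so the exceptional set for `Z` gives one for `X`.
  have hqmp : Measure.QuasiMeasurePreserving (fun x : ℝ => 4 / σ ^ 2 * x) volume volume := by
    refine ⟨by fun_prop, ?_⟩
    rw [Real.map_volume_mul_left hc.ne']
    exact Measure.smul_absolutelyContinuous
  filter_upwards [hqmp.ae hscore] with x hx hx0
  obtain ⟨hi, hd⟩ := hx (mul_pos hc hx0)
  refine ⟨hi, ?_⟩
  -- Here `log (c p(cy)) = log c + log p(cy)` with `c = 4/σ²`: the constant drops out and the chain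
  -- rule gives the factor `c`.
  have hd' := (hd.scomp x ((hasDerivAt_id x).const_mul (4 / σ ^ 2))).const_add
    (Real.log (4 / σ ^ 2))
  refine (hd'.congr_of_eventuallyEq ?_).congr_deriv (by simp)
  filter_upwards [Ioi_mem_nhds hx0] with y hy
  rw [Real.log_mul hc.ne' (hp.pos _ (mul_pos hc hy)).ne']
  rfl
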